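/- Let $G$ and $H$ be countably infinite amenable discrete groups, neither of which is locally virtually cyclic; that is, each has a finitely generated subgroup that contains no cyclic (possibly finite) subgroup of finite index. Let $G\curvearrowright X$ and $H\curvearrowright Y$ be continuous actions on compact metrizable spaces which are topologically free, i.e. the points with trivial stabilizer are dense. Suppose the two actions are continuously orbit equivalent: there are a homeomorphism $\Phi:X\to Y$ and continuous maps $\kappa:G\times X\to H$ and $\lambda:H\times Y\to G$ with $$\Phi(sx)=\kappa(s,x)\,\Phi(x),\qquad \Phi^{-1}(ty)=\lambda(t,y)\,\Phi^{-1}(y)$$ for all $s\in G$, $x\in X$, $t\in H$, $y\in Y$. Then the two actions have the same topological entropy: $$h_{\mathrm{top}}(G\curvearrowright X)=h_{\mathrm{top}}(H\curvearrowright Y)\in[0,\infty].$$ Here a Følner sequence for $G$ is a sequence $(F_n)$ of nonempty finite subsets of $G$ with $|gF_n\,\triangle\,F_n|/|F_n|\to 0$ for every $g\in G$, and $$h_{\mathrm{top}}(G\curvearrowright X)=\sup_{\mathcal U}\ \limsup_{n\to\infty}\frac1{|F_n|}\log N\big(\mathcal U^{F_n}\big),$$ where $\mathcal U$ ranges over the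 finite open covers of $X$, $\mathcal U^{F}$ is the cover consisting of all sets $\bigcap_{s\in F}s^{-1}U_s$ with $U_s\in\mathcal U$, and $N(\cdot)$ is the minimum cardinality of a subcover (the $\limsup$ is in fact a limit, and the value does not depend on the Følner sequence); similarly for $H\curvearrowright Y$. The equality holds for every choice of Følner sequences of $G$ and of $H$ used to compute the two entropies. -/

import Mathlib

open Filter Topology MeasureTheory
open scoped ENNReal Pointwise

noncomputable section

namespace OrbitEntropy

/-- A group is amenable (as a discrete group) if it carries a left-invariant mean: a finitely
additive probability measure defined on all subsets and invariant under left translation. -/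
def IsAmenable (G : Type*) [Group G] : Prop :=
  ∃ m : Set G → ℝ≥0∞, m Set.univ = 1 ∧
    (∀ s t : Set G, Disjoint s t → m (s ∪ t) = m s + m t) ∧
    ∀ (g : G) (s : Set G), m (g • s) = m s

/-- A group is virtually cyclic if it has a cyclic subgroup of finite index
(in particular every finite group is virtually cyclic). -/
def IsVirtuallyCyclic (G : Type*) [Group G] : Prop :=
  ∃ C : Subgroup G, IsCyclic C ∧ C.FiniteIndex

/-- Every finitely generated subgroup is virtually cyclic. -/
def IsLocallyVirtuallyCyclic (G : Type*) [Group G] : Prop :=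
  ∀ K : Subgroup G, K.FG → IsVirtuallyCyclic K

/-- The points with trivial stabilizer are dense. -/
def IsTopologicallyFree (G X : Type*) [Group G] [TopologicalSpace X] [MulAction G X] : Prop :=
  Dense {x : X | MulAction.stabilizer G x = ⊥}

/-- Continuous orbit equivalence of the actions of `G` on `X` and of `H` on `Y`. -/
def ContinuouslyOrbitEquivalent (G X H Y : Type*)
    [Group G] [TopologicalSpace G] [TopologicalSpace X] [MulAction G X]
    [Group H] [TopologicalSpace H] [TopologicalSpace Y] [MulAction H Y] : Prop :=
  ∃ (Φ : X ≃ₜ Y) (κ : G × X → H) (l : H × Y → G),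
    Continuous κ ∧ Continuous l ∧
    (∀ (s : G) (x : X), Φ (s • x) = κ (s, x) • Φ x) ∧
    (∀ (t : H) (y : Y), Φ.symm (t • y) = l (t, y) • Φ.symm y)

/-- A (left) Følner sequence of finite subsets of the discrete group `G`: the sets are eventually
nonempty and `|g F n ∆ F n| / |F n| → 0` for every `g`. This is the Mathlib notion for the
left translation action of `G` on itself and the counting measure. -/
def IsFolnerSeq {G : Type*} [Group G] (F : ℕ → Finset G) : Prop :=
  letI : MeasurableSpace G := ⊤
  IsFoelner G (Measure.count : Measure G) atTop (fun n ↦ (F n : Set G))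

/-- Finite open covers of `X`. -/
structure IsFiniteOpenCover {X : Type*} [TopologicalSpace X] (𝒰 : Set (Set X)) : Prop where
  finite : 𝒰.Finite
  isOpen : ∀ U ∈ 𝒰, IsOpen U
  cover : ⋃₀ 𝒰 = Set.univ

/-- `N(𝒰)`, the minimum cardinality of a (finite) subcover of `𝒰`. -/
def minSubcover {X : Type*} (𝒰 : Set (Set X)) : ℕ :=
  sInf {n : ℕ | ∃ 𝒱 ⊆ 𝒰, 𝒱.Finite ∧ ⋃₀ 𝒱 = Set.univ ∧ 𝒱.ncard = n}

/-- The join `𝒰^F = ⋁_{s ∈ F} s⁻¹ 𝒰`: all sets `⋂_{s ∈ F} s⁻¹ U_s` with `U_s ∈ 𝒰`. -/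
def coverJoin {G X : Type*} [Group G] [MulAction G X] (𝒰 : Set (Set X)) (F : Finset G) :
    Set (Set X) :=
  {W | ∃ U : G → Set X, (∀ s ∈ F, U s ∈ 𝒰) ∧ W = ⋂ s ∈ F, s⁻¹ • U s}

/-- The topological entropy of the action of `G` on `X`, computed along the sequence `F`
(meant for Følner sequences): the supremum over finite open covers `𝒰` of the exponential growth
rate of `N(𝒰^{F n})` relative to `|F n|`. -/
def topEntropy {G : Type*} (X : Type*) [Group G] [TopologicalSpace X] [MulAction G X]
    (F : ℕ → Finset G) : EReal :=
  ⨆ 𝒰 : {𝒰 : Set (Set X) // IsFiniteOpenCover 𝒰},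
    limsup (fun n : ℕ ↦
      ((Real.log (minSubcover (coverJoin 𝒰.1 (F n))) / ((F n).card : ℝ) : ℝ) : EReal)) atTop

end OrbitEntropy

end

/-! By symmetry it suffices to bound the entropy on `Y` by that on `X`. Topological freeness and
density turn the two maps of the orbit equivalence into mutually inverse cocycles `k`, `l`, taking
finitely many values for each fixed group element. A finite `T ⊆ H` becomes, along the orbit of `x`,
a shape `{l t x | t ∈ T}` in `G`: it has the same size, and it is almost invariant when `T` is. If
`a` exceeds the entropy on `X`, Ornstein–Weiss quasi-tiling (`exists_forall_le_of_supply`) gives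
`log N(𝒰^A) ≤ (a + η)|A|` for every sufficiently invariant `A`, hence for every such shape.

Let `𝒰` be the pullback of a cover `𝒱` of `Y`, refined by the level sets of `l s`, `s ∈ S`. Once the
shape and the values of `l` at one base point per `S`-component of `T` are fixed, a member of the
join of `𝒰` over the shape determines `l` on all of `T` and refines the join of `𝒱` over `T`
(`log_minSubcover_le`). It remains to see that only `exp(small · |T|)` combinations of shapes and
base values occur.

Here growth enters. A finitely generated group of linear growth is virtually cyclic, so `H` contains
a finite symmetric `S` with `|S^r| / r` unbounded (`exists_superlinear_growth`). Take in `T` a net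
with disjoint `S^r`-balls: it has about `|T| / |S^r|` points, and propagating `l` from one net point
to the next costs a factor exponential in `r`, so the total exponent is of order `|T| r / |S^r|`
(`exists_net`). The net values confine the shape to a set of size `O(|T|)`. The shape is then
recovered from its boundary edges and the base values (`shape_subset_of_bdryEdges_eq`), and there
are few possible small sets of boundary edges. -/

namespace OrbitEntropy

/-! ### Quasi-tilings and the Ornstein–Weiss lemma -/

section QuasiTiling

variable {G : Type*} [Group G] [DecidableEq G]

/-- The size of the boundary of `F` with respect to left translation by the elements of `K`. -/
def bdry (K F : Finset G) : ℕ := ∑ k ∈ K, (F.filter fun f ↦ k * f ∉ F).card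

/-- Right translate of a finite set. -/
def rtrans (F : Finset G) (c : G) : Finset G := F.image (· * c)

lemma card_rtrans (F : Finset G) (c : G) : (rtrans F c).card = F.card :=
  Finset.card_image_of_injective _ (mul_left_injective c)

lemma mem_rtrans {F : Finset G} {c g : G} : g ∈ rtrans F c ↔ g * c⁻¹ ∈ F := by
  simp only [rtrans, Finset.mem_image]
  constructor
  · rintro ⟨a, ha, rfl⟩
    simpa using ha
  · intro h
    exact ⟨_, h, by simp⟩

/-- Subadditive right-invariant functions on the finite subsets of a group. -/
structure IsSubInv (ψ : Finset G → ℝ) : Prop where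
  empty : ψ ∅ ≤ 0
  union : ∀ A B, ψ (A ∪ B) ≤ ψ A + ψ B
  inv : ∀ A c, ψ (rtrans A c) ≤ ψ A

lemma bdry_union (K A B : Finset G) : bdry K (A ∪ B) ≤ bdry K A + bdry K B := by
  unfold bdry
  rw [← Finset.sum_add_distrib]
  refine Finset.sum_le_sum fun k _ ↦ ?_
  refine (Finset.card_le_card (t := (A.filter fun f ↦ k * f ∉ A) ∪
    (B.filter fun f ↦ k * f ∉ B)) ?_).trans (Finset.card_union_le _ _)
  intro f
  simp only [Finset.mem_filter, Finset.mem_union]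
  tauto

lemma bdry_rtrans (K A : Finset G) (c : G) : bdry K (rtrans A c) = bdry K A := by
  unfold bdry
  refine Finset.sum_congr rfl fun k _ ↦ ?_
  rw [← card_rtrans (A.filter fun f ↦ k * f ∉ A) c]
  congr 1
  ext f
  simp only [Finset.mem_filter, mem_rtrans, mul_assoc]

lemma bdry_mono {K K' : Finset G} (h : K ⊆ K') (A : Finset G) : bdry K A ≤ bdry K' A :=
  Finset.sum_le_sum_of_subset h

lemma isSubInv_bdry (K : Finset G) : IsSubInv (fun F ↦ (bdry K F : ℝ)) where
  empty := by simp [bdry]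
  union A B := by exact_mod_cast bdry_union K A B
  inv A c := by rw [bdry_rtrans]

lemma IsSubInv.le_card {ψ : Finset G → ℝ} (h : IsSubInv ψ) (F : Finset G) :
    ψ F ≤ F.card * ψ {1} := by
  induction F using Finset.induction_on with
  | empty => simpa using h.empty
  | insert a s ha ih =>
    have h1 := h.union {a} s
    have h2 := h.inv {1} a
    have h3 : rtrans {1} a = {a} := by simp [rtrans]
    rw [h3] at h2
    rw [Finset.card_insert_of_notMem ha, Finset.insert_eq]
    push_cast
    linarith

/-- Greedy choice of almost disjoint right translates of `T` inside `F`, away from `Z₀`. -/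
lemma exists_greedy {T F Z₀ : Finset G} (hT : T.Nonempty) (hZ : Z₀ ⊆ F) {ε : ℝ}
    (hε1 : ε < 1) :
    ∃ Z, Z₀ ⊆ Z ∧ Z ⊆ F ∧
      (∀ ψ : Finset G → ℝ, IsSubInv ψ → 0 ≤ ψ T → ∀ a, ψ T ≤ a * T.card →
        ψ Z ≤ ψ Z₀ + a / (1 - ε) * ((Z.card : ℝ) - Z₀.card)) ∧
      ∀ c, rtrans T c ⊆ F → ε * T.card < ((rtrans T c ∩ Z).card : ℝ) := by
  classical
  -- The bound is kept for all `ψ` at once, so that the same maximal `Z` can later be used both for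
  -- the given function and for a boundary function.
  let P : Finset G → Prop := fun Z ↦ Z₀ ⊆ Z ∧
    (∀ ψ : Finset G → ℝ, IsSubInv ψ → 0 ≤ ψ T → ∀ a, ψ T ≤ a * T.card →
        ψ Z ≤ ψ Z₀ + a / (1 - ε) * ((Z.card : ℝ) - Z₀.card))
  have hne : (F.powerset.filter P).Nonempty := ⟨Z₀, by simp [P, hZ]⟩
  obtain ⟨Z, hZm, hmax⟩ := Finset.exists_max_image _ Finset.card hne
  simp only [Finset.mem_filter, Finset.mem_powerset] at hZm hmax
  refine ⟨Z, hZm.2.1, hZm.1, hZm.2.2, ?_⟩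
  intro c hc
  by_contra! hcon
  have hTpos : (0 : ℝ) < T.card := by exact_mod_cast hT.card_pos
  have hcard : ((Z ∪ rtrans T c).card : ℝ) + ((rtrans T c ∩ Z).card : ℝ) = Z.card + T.card := by
    rw [Finset.inter_comm, ← card_rtrans T c]
    exact_mod_cast Finset.card_union_add_card_inter Z (rtrans T c)
  have hgrow : (1 - ε) * T.card ≤ ((Z ∪ rtrans T c).card : ℝ) - Z.card := by linarith
  have hP : Z ∪ rtrans T c ⊆ F ∧ P (Z ∪ rtrans T c) := by
    refine ⟨Finset.union_subset hZm.1 hc, hZm.2.1.trans Finset.subset_union_left, ?_⟩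
    intro ψ hψ h0 a ha
    have h1 := hψ.union Z (rtrans T c)
    have h2 := hψ.inv T c
    have h3 := hZm.2.2 ψ hψ h0 a ha
    have ha0 : 0 ≤ a := by
      by_contra! hneg
      nlinarith
    have h4 : a * T.card ≤ a / (1 - ε) * (((Z ∪ rtrans T c).card : ℝ) - Z.card) := by
      have : a * T.card = a / (1 - ε) * ((1 - ε) * T.card) := by
        have : 1 - ε ≠ 0 := by linarith
        field_simp
      rw [this]
      exact mul_le_mul_of_nonneg_left hgrow (div_nonneg ha0 (by linarith))
    nlinarith
  have := hmax _ hP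
  have h5 : ((Z ∪ rtrans T c).card : ℝ) ≤ Z.card := by exact_mod_cast this
  nlinarith

lemma card_filter_exists_le_bdry (K F : Finset G) :
    (F.filter fun f ↦ ∃ k ∈ K, k * f ∉ F).card ≤ bdry K F := by
  unfold bdry
  refine (Finset.card_le_card ?_).trans Finset.card_biUnion_le
  intro f
  simp only [Finset.mem_filter, Finset.mem_biUnion]
  tauto

/-- If `c ∉ Z` and `t * c ∈ Z`, then `t * c` is a point of `Z` that `t⁻¹` moves out of `Z`. -/
lemma card_outer_le_bdry (T F Z : Finset G) :
    ((F \ Z).filter fun c ↦ ∃ t ∈ T, t * c ∈ Z).card ≤ bdry T⁻¹ Z := by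
  unfold bdry
  calc _ ≤ (T.biUnion fun t ↦ (Z.filter fun z ↦ t⁻¹ * z ∉ Z).image (t⁻¹ * ·)).card := by
        refine Finset.card_le_card ?_
        intro c
        simp only [Finset.mem_filter, Finset.mem_biUnion, Finset.mem_sdiff, Finset.mem_image]
        rintro ⟨⟨_, hc⟩, t, ht, htc⟩
        exact ⟨t, ht, t * c, ⟨htc, by simpa using hc⟩, by simp⟩
    _ ≤ ∑ t ∈ T, ((Z.filter fun z ↦ t⁻¹ * z ∉ Z).image (t⁻¹ * ·)).card :=
        Finset.card_biUnion_le
    _ ≤ ∑ t ∈ T, (Z.filter fun z ↦ t⁻¹ * z ∉ Z).card :=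
        Finset.sum_le_sum fun _ _ ↦ Finset.card_image_le
    _ = ∑ k ∈ T⁻¹, (Z.filter fun z ↦ k * z ∉ Z).card := by
        rw [Finset.sum_inv_index]

lemma sum_card_rtrans_inter_le (T C W : Finset G) :
    ∑ c ∈ C, (rtrans T c ∩ W).card ≤ T.card * W.card := by
  calc ∑ c ∈ C, (rtrans T c ∩ W).card ≤ ∑ c ∈ C, ∑ t ∈ T, if t * c ∈ W then 1 else 0 := by
        refine Finset.sum_le_sum fun c _ ↦ ?_
        rw [← Finset.card_filter]
        rw [← card_rtrans (T.filter fun t ↦ t * c ∈ W) c]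
        refine Finset.card_le_card ?_
        intro g
        simp only [Finset.mem_inter, mem_rtrans, Finset.mem_filter]
        rintro ⟨h1, h2⟩
        exact ⟨h1, by simpa using h2⟩
    _ = ∑ t ∈ T, ∑ c ∈ C, if t * c ∈ W then 1 else 0 := Finset.sum_comm
    _ ≤ ∑ t ∈ T, W.card := by
        refine Finset.sum_le_sum fun t _ ↦ ?_
        rw [← Finset.card_filter]
        refine Finset.card_le_card_of_injOn (t * ·) ?_ ((mul_right_injective t).injOn)
        intro c hc
        simp only [Finset.coe_filter, Set.mem_ofPred_eq] at hc
        exact hc.2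
    _ = T.card * W.card := by simp

/-- If there are arbitrarily invariant sets `T` with `ψ T ≤ a |T|`, then every sufficiently
invariant set is covered up to a small proportion by a subset `Z` with
`ψ Z ≤ a / (1 - ε) |Z|`. -/
lemma exists_quasiTiling {ψ : Finset G → ℝ} (hψ : IsSubInv ψ) (h0 : ∀ F, 0 ≤ ψ F) {a : ℝ}
    (hsup : ∀ (K : Finset G) (δ : ℝ), 0 < δ →
      ∃ T : Finset G, T.Nonempty ∧ (bdry K T : ℝ) ≤ δ * T.card ∧ ψ T ≤ a * T.card)
    {ε : ℝ} (hε0 : 0 < ε) (hε1 : ε < 1) (k : ℕ) :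
    ∀ (K₀ : Finset G) (δ₀ : ℝ), 0 < δ₀ → ∃ (K : Finset G) (δ : ℝ), 0 < δ ∧
      ∀ F : Finset G, (bdry K F : ℝ) ≤ δ * F.card → ∃ Z ⊆ F,
        ψ Z ≤ a / (1 - ε) * Z.card ∧ (bdry K₀ Z : ℝ) ≤ δ₀ * Z.card ∧
        ((F \ Z).card : ℝ) ≤ (1 - ε / 2) ^ k * F.card := by
  induction k with
  | zero =>
    intro K₀ δ₀ _
    refine ⟨∅, 1, one_pos, fun F _ ↦ ⟨∅, by simp, ?_, ?_, ?_⟩⟩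
    · simpa using hψ.empty
    · simp [bdry]
    · simp
  | succ k ih =>
    intro K₀ δ₀ hδ₀
    -- The tile used last is chosen first: the earlier tiles must be invariant under `T⁻¹`, so that
    -- the part they leave uncovered is nearly `T`-invariant. The factor `1 - ε` pays for the
    -- overlaps in the greedy step.
    obtain ⟨T, hTne, hTb, hTψ⟩ := hsup K₀ (δ₀ * (1 - ε)) (by nlinarith)
    set ρ : ℝ := (1 - ε / 2) ^ k with hρ
    have hρ0 : 0 < ρ := pow_pos (by linarith) k
    obtain ⟨K, δ, hδ, hK⟩ := ih (K₀ ∪ T⁻¹) (min δ₀ (ρ / 4)) (by positivity)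
    refine ⟨K ∪ T, min δ (ρ / 4), by positivity, fun F hF ↦ ?_⟩
    have hFK : (bdry K F : ℝ) ≤ δ * F.card := by
      calc (bdry K F : ℝ) ≤ bdry (K ∪ T) F := by
            exact_mod_cast bdry_mono Finset.subset_union_left F
        _ ≤ _ := hF
        _ ≤ _ := by gcongr; exact min_le_left _ _
    have hFT : (bdry T F : ℝ) ≤ ρ / 4 * F.card := by
      calc (bdry T F : ℝ) ≤ bdry (K ∪ T) F := by
            exact_mod_cast bdry_mono Finset.subset_union_right F
        _ ≤ _ := hF
        _ ≤ _ := by gcongr; exact min_le_right _ _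
    obtain ⟨Z₀, hZ₀F, hZ₀ψ, hZ₀b, hZ₀r⟩ := hK F hFK
    have hb1 : (bdry K₀ Z₀ : ℝ) ≤ δ₀ * Z₀.card := by
      calc (bdry K₀ Z₀ : ℝ) ≤ bdry (K₀ ∪ T⁻¹) Z₀ := by
            exact_mod_cast bdry_mono Finset.subset_union_left _
        _ ≤ _ := hZ₀b
        _ ≤ _ := by gcongr; exact min_le_left _ _
    have hb2 : (bdry T⁻¹ Z₀ : ℝ) ≤ ρ / 4 * F.card := by
      calc (bdry T⁻¹ Z₀ : ℝ) ≤ bdry (K₀ ∪ T⁻¹) Z₀ := by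
            exact_mod_cast bdry_mono Finset.subset_union_right _
        _ ≤ _ := hZ₀b
        _ ≤ ρ / 4 * Z₀.card := by gcongr; exact min_le_right _ _
        _ ≤ _ := by gcongr
    obtain ⟨Z, hZ₀Z, hZF, hZψ, hZc⟩ := exists_greedy hTne hZ₀F hε1
    refine ⟨Z, hZF, ?_, ?_, ?_⟩
    · have := hZψ ψ hψ (h0 T) a hTψ
      linarith
    · have := hZψ _ (isSubInv_bdry K₀) (Nat.cast_nonneg _) _ hTb
      have h1 : δ₀ * (1 - ε) / (1 - ε) = δ₀ := by
        have : 1 - ε ≠ 0 := by linarith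
        field_simp
      rw [h1] at this
      linarith
    -- `C` consists of the centres whose tile lies in `F \ Z₀`; all but `ρ/2 * |F|` points of `F \
    -- Z₀` qualify. Each such tile is `ε`-covered by `Z \ Z₀`, so double counting gives `|Z \ Z₀| ≥
    -- ε |C|`. The uncovered part is thus at most `(1 - ε)ρ + ερ/2 = ρ(1 - ε/2)` times `|F|`.
    · set C : Finset G := (F \ Z₀).filter fun c ↦ ∀ t ∈ T, t * c ∈ F ∧ t * c ∉ Z₀ with hC
      have hcount : (F \ Z₀).card ≤ C.card + bdry T F + bdry T⁻¹ Z₀ := by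
        calc (F \ Z₀).card ≤ (C ∪ (F.filter fun f ↦ ∃ k ∈ T, k * f ∉ F) ∪
              ((F \ Z₀).filter fun c ↦ ∃ t ∈ T, t * c ∈ Z₀)).card := by
              refine Finset.card_le_card fun f hf ↦ ?_
              simp only [hC, Finset.mem_union, Finset.mem_filter, hf, true_and,
                (Finset.mem_sdiff.1 hf).1]
              by_contra! hcon
              obtain ⟨⟨⟨t, ht, h1⟩, h2⟩, h3⟩ := hcon
              exact h3 t ht (h1 (h2 t ht))
          _ ≤ _ := by
              refine (Finset.card_union_le _ _).trans ?_
              refine add_le_add ((Finset.card_union_le _ _).trans ?_) (card_outer_le_bdry T F Z₀)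
              exact add_le_add le_rfl (card_filter_exists_le_bdry T F)
      have hTpos : (0 : ℝ) < T.card := by exact_mod_cast hTne.card_pos
      have hsum : ε * T.card * C.card ≤ T.card * ((Z \ Z₀).card : ℝ) := by
        calc ε * T.card * C.card = ∑ c ∈ C, ε * T.card := by simp; ring
          _ ≤ ∑ c ∈ C, ((rtrans T c ∩ (Z \ Z₀)).card : ℝ) := by
              refine Finset.sum_le_sum fun c hc ↦ ?_
              simp only [hC, Finset.mem_filter] at hc
              have hsub : rtrans T c ⊆ F := by
                intro g hg
                have := (hc.2 _ (mem_rtrans.1 hg)).1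
                simpa using this
              have heq : rtrans T c ∩ Z = rtrans T c ∩ (Z \ Z₀) := by
                ext g
                simp only [Finset.mem_inter, Finset.mem_sdiff]
                constructor
                · rintro ⟨hg, hgZ⟩
                  have := (hc.2 _ (mem_rtrans.1 hg)).2
                  exact ⟨hg, hgZ, by simpa using this⟩
                · tauto
              rw [← heq]
              exact (hZc c hsub).le
          _ ≤ T.card * ((Z \ Z₀).card : ℝ) := by
              exact_mod_cast sum_card_rtrans_inter_le T C (Z \ Z₀)
      have hC' : ε * C.card ≤ ((Z \ Z₀).card : ℝ) := by
        by_contra! hcon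
        nlinarith
      have hsplit : (F \ Z₀).card = (F \ Z).card + (Z \ Z₀).card := by
        rw [← Finset.card_union_of_disjoint]
        · congr 1
          ext g
          simp only [Finset.mem_union, Finset.mem_sdiff]
          constructor
          · rintro ⟨h1, h2⟩
            by_cases h : g ∈ Z <;> tauto
          · rintro (⟨h1, h2⟩ | ⟨h1, h2⟩)
            · exact ⟨h1, fun h ↦ h2 (hZ₀Z h)⟩
            · exact ⟨hZF h1, h2⟩
        · rw [Finset.disjoint_left]
          intro g hg hg'
          exact (Finset.mem_sdiff.1 hg).2 (Finset.mem_sdiff.1 hg').1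
      have hsplit' : ((F \ Z₀).card : ℝ) = (F \ Z).card + (Z \ Z₀).card := by
        exact_mod_cast hsplit
      have hcount' : ((F \ Z₀).card : ℝ) ≤ C.card + bdry T F + bdry T⁻¹ Z₀ := by
        exact_mod_cast hcount
      rw [pow_succ, ← hρ]
      nlinarith

/-- A form of the Ornstein–Weiss lemma. -/
theorem exists_forall_le_of_supply {ψ : Finset G → ℝ} (hψ : IsSubInv ψ) (h0 : ∀ F, 0 ≤ ψ F)
    {a : ℝ} (ha : 0 ≤ a)
    (hsup : ∀ (K : Finset G) (δ : ℝ), 0 < δ →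
      ∃ T : Finset G, T.Nonempty ∧ (bdry K T : ℝ) ≤ δ * T.card ∧ ψ T ≤ a * T.card)
    {η : ℝ} (hη : 0 < η) :
    ∃ (K : Finset G) (δ : ℝ), 0 < δ ∧
      ∀ F : Finset G, (bdry K F : ℝ) ≤ δ * F.card → ψ F ≤ (a + η) * F.card := by
  obtain ⟨ε, hε0, hε1, hεa⟩ : ∃ ε : ℝ, 0 < ε ∧ ε < 1 ∧ a / (1 - ε) ≤ a + η / 2 := by
    refine ⟨η / (2 * a + η + 1), by positivity, ?_, ?_⟩
    · rw [div_lt_one (by positivity)]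
      linarith
    · have h1 : 1 - η / (2 * a + η + 1) = (2 * a + 1) / (2 * a + η + 1) := by
        field_simp
        ring
      rw [h1, div_div_eq_mul_div, div_le_iff₀ (by positivity)]
      nlinarith
  have hC0 : 0 ≤ ψ {1} := h0 _
  -- The uncovered remainder is charged at the trivial rate `ψ {1}` per point.
  obtain ⟨k, hk⟩ : ∃ k : ℕ, (1 - ε / 2) ^ k < η / (2 * (ψ {1} + 1)) :=
    exists_pow_lt_of_lt_one (by positivity) (by linarith)
  obtain ⟨K, δ, hδ, hK⟩ := exists_quasiTiling hψ h0 hsup hε0 hε1 k ∅ 1 one_pos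
  refine ⟨K, δ, hδ, fun F hF ↦ ?_⟩
  obtain ⟨Z, hZF, hZψ, -, hZr⟩ := hK F hF
  have h1 : ψ F ≤ ψ Z + ψ (F \ Z) := by
    have := hψ.union Z (F \ Z)
    rwa [Finset.union_sdiff_of_subset hZF] at this
  have h2 := hψ.le_card (F \ Z)
  have h3 : (Z.card : ℝ) ≤ F.card := by exact_mod_cast Finset.card_le_card hZF
  have h4 : a / (1 - ε) * Z.card ≤ (a + η / 2) * F.card :=
    mul_le_mul hεa h3 (by positivity) (by positivity)
  have h5 : ((F \ Z).card : ℝ) * ψ {1} ≤ η / 2 * F.card := by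
    have h6 : ((F \ Z).card : ℝ) ≤ η / (2 * (ψ {1} + 1)) * F.card :=
      hZr.trans (by gcongr)
    calc ((F \ Z).card : ℝ) * ψ {1} ≤ η / (2 * (ψ {1} + 1)) * F.card * ψ {1} := by gcongr
      _ = η / 2 * F.card * (ψ {1} / (ψ {1} + 1)) := by field_simp
      _ ≤ η / 2 * F.card * 1 := by
          gcongr
          rw [div_le_one (by positivity)]
          linarith
      _ = _ := by ring
  linarith

end QuasiTiling

/-! ### Factor complexity of infinite words -/

section Words

/-- The factor of length `n` at position `i` of an infinite word. -/
def factor {α : Type*} (w : ℕ → α) (i n : ℕ) : List α := (List.range n).map fun j ↦ w (i + j)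

variable {α : Type*} (w : ℕ → α)

@[simp] lemma length_factor (i n : ℕ) : (factor w i n).length = n := by simp [factor]

lemma factor_add (i m n : ℕ) : factor w i (m + n) = factor w i m ++ factor w (i + m) n := by
  simp [factor, List.range_add, Function.comp_def, add_assoc]

lemma factor_succ (i n : ℕ) : factor w i (n + 1) = factor w i n ++ [w (i + n)] := by
  simp [factor, List.range_succ]

lemma factor_succ' (i n : ℕ) : factor w i (n + 1) = w i :: factor w (i + 1) n := by
  rw [add_comm n 1, factor_add]
  simp [factor]

lemma finite_range_factor [Finite α] (n : ℕ) : (Set.range fun i ↦ factor w i n).Finite :=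
  (List.finite_length_eq α n).subset (by rintro _ ⟨i, rfl⟩; simp)

/-- If the number of factors does not grow from length `n` to length `n + 1`, then the word is
eventually periodic (Morse–Hedlund). -/
lemma exists_period [Finite α] {n : ℕ}
    (h : (Set.range fun i ↦ factor w i (n + 1)).ncard ≤ (Set.range fun i ↦ factor w i n).ncard) :
    ∃ i d, 0 < d ∧ ∀ k, w (i + d + k) = w (i + k) := by
  -- Truncation maps the factors of length `n + 1` onto those of length `n`; without growth in
  -- number it is injective, so a factor of length `n` determines the next letter.
  have hinj : Set.InjOn (List.take n) (Set.range fun i ↦ factor w i (n + 1)) := by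
    have himg : List.take n '' (Set.range fun i ↦ factor w i (n + 1)) =
        Set.range fun i ↦ factor w i n := by
      rw [← Set.range_comp]
      congr 1
      funext i
      simp [factor_succ]
    refine Set.injOn_of_ncard_image_eq ?_ (finite_range_factor w _)
    refine le_antisymm (Set.ncard_image_le (finite_range_factor w _)) ?_
    rw [himg]
    exact h
  have hstep : ∀ i j, factor w i n = factor w j n → factor w i (n + 1) = factor w j (n + 1) := by
    intro i j hij
    refine hinj ⟨i, rfl⟩ ⟨j, rfl⟩ ?_
    simpa [factor_succ] using hij
  have hshift : ∀ i j, factor w i n = factor w j n →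
      ∀ k, factor w (i + k) n = factor w (j + k) n := by
    intro i j hij k
    induction k with
    | zero => simpa using hij
    | succ k ih =>
      have := hstep _ _ ih
      rw [factor_succ', factor_succ'] at this
      exact (List.cons.inj this).2
  obtain ⟨i, -, j, -, hij, heq⟩ := Set.infinite_univ.exists_lt_map_eq_of_mapsTo
    (f := fun i ↦ factor w i n) (t := Set.range fun i ↦ factor w i n)
    (fun i _ ↦ ⟨i, rfl⟩) (finite_range_factor w n)
  refine ⟨i, j - i, by omega, fun k ↦ ?_⟩
  have := hstep _ _ (hshift i j heq k)
  rw [factor_succ', factor_succ'] at this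
  rw [show i + (j - i) = j by omega]
  exact (List.cons.inj this).1.symm

end Words

/-! ### Linear growth forces virtual cyclicity -/

section Growth

variable {Γ : Type*} [Group Γ]

/-- The value in the group of a word in the elements of `S`. -/
def wordVal {S : Finset Γ} (w : List S) : Γ := (w.map Subtype.val).prod

/-- Words that are shortlex-minimal among the words with the same value. -/
def IsReduced {S : Finset Γ} (w : List S) : Prop :=
  ∀ w', wordVal w' = wordVal w → ¬ List.Shortlex WellOrderingRel w' w

variable {S : Finset Γ}

lemma wordVal_append (u v : List S) : wordVal (u ++ v) = wordVal u * wordVal v := by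
  simp [wordVal]

/-- Appending on the right respects the lexicographic order only between words of equal length;
shortlex compares lengths first, which removes the bad case of a proper prefix. -/
lemma shortlex_append_of_shortlex {α : Type*} {r : α → α → Prop} {s t : List α}
    (h : List.Shortlex r s t) (u : List α) : List.Shortlex r (s ++ u) (t ++ u) := by
  rcases List.shortlex_def.1 h with hlt | ⟨heq, hlex⟩
  · exact List.Shortlex.of_length_lt (by simpa using hlt)
  · refine List.Shortlex.of_lex (by simpa using heq) ?_
    clear h
    induction hlex with
    | nil => simp at heq
    | cons _ ih => exact List.Lex.cons (ih (by simpa using heq))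
    | rel h => exact List.Lex.rel h

lemma IsReduced.of_append_left {u v : List S} (h : IsReduced (u ++ v)) : IsReduced u := by
  intro w' hw' hlt
  exact h (w' ++ v) (by simp [wordVal_append, hw']) (shortlex_append_of_shortlex hlt _)

lemma IsReduced.of_append_right {u v : List S} (h : IsReduced (u ++ v)) : IsReduced v := by
  intro w' hw' hlt
  exact h (u ++ w') (by simp [wordVal_append, hw']) (hlt.append_left _)

lemma IsReduced.eq_of_wordVal_eq {u v : List S} (hu : IsReduced u) (hv : IsReduced v)
    (h : wordVal u = wordVal v) : u = v :=
  Std.Trichotomous.trichotomous (r := List.Shortlex WellOrderingRel) u v (hv u h) (hu v h.symm)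

lemma exists_isReduced (u : List S) : ∃ v : List S, IsReduced v ∧ wordVal v = wordVal u := by
  have hwf : WellFounded (List.Shortlex (WellOrderingRel (α := S))) :=
    List.Shortlex.wf WellOrderingRel.isWellOrder.wf
  obtain ⟨v, hv, hmin⟩ := hwf.has_min {v : List S | wordVal v = wordVal u} ⟨u, rfl⟩
  exact ⟨v, fun w' hw' ↦ hmin w' (hw'.trans hv), hv⟩

lemma wordVal_factor_mul {w : ℕ → S} {i d : ℕ} (h : ∀ k, w (i + d + k) = w (i + k)) (k : ℕ) :
    wordVal (factor w i (k * d)) = wordVal (factor w i d) ^ k := by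
  have hper : ∀ k, factor w (i + k * d) d = factor w i d := by
    intro k
    induction k with
    | zero => simp
    | succ k ih =>
      rw [← ih]
      unfold factor
      refine List.map_congr_left fun j _ ↦ ?_
      have := h (k * d + j)
      rw [add_assoc i (k * d) j, ← this]
      congr 1
      ring
  induction k with
  | zero => simp [factor, wordVal]
  | succ k ih =>
    rw [add_mul, one_mul, factor_add, wordVal_append, ih, hper, pow_succ]

variable [DecidableEq Γ]

lemma wordVal_mem_pow (w : List S) : wordVal w ∈ S ^ w.length := by
  induction w with
  | nil => simp [wordVal]
  | cons a w ih =>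
    rw [List.length_cons, pow_succ']
    simp only [wordVal, List.map_cons, List.prod_cons]
    exact Finset.mul_mem_mul a.2 ih

lemma exists_wordVal_eq {n : ℕ} {g : Γ} (h : g ∈ S ^ n) : ∃ w : List S, wordVal w = g := by
  obtain ⟨f, hf⟩ := Finset.mem_pow.1 h
  refine ⟨List.ofFn f, ?_⟩
  rw [← hf, wordVal, List.map_ofFn]
  rfl

lemma pow_subset_pow_of_one_mem (h1 : (1 : Γ) ∈ S) {m n : ℕ} (h : m ≤ n) : S ^ m ⊆ S ^ n :=
  Finset.pow_subset_pow_right h1 h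

/-- An infinite word all of whose factors are reduced. -/
lemma exists_infinite_reduced_word [Infinite Γ] (h1 : (1 : Γ) ∈ S)
    (hgen : ∀ g : Γ, ∃ n, g ∈ S ^ n) : ∃ w : ℕ → S, ∀ i n, IsReduced (factor w i n) := by
  let _ : TopologicalSpace S := ⊥
  have : DiscreteTopology S := ⟨rfl⟩
  -- König's lemma as compactness of `ℕ → S`. Only prefixes are required to be reduced; every factor
  -- is a suffix of a prefix, hence reduced too.
  let C : ℕ → Set (ℕ → S) := fun n ↦ {w | IsReduced (factor w 0 n)}
  have hclosed : ∀ n, IsClosed (C n) := by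
    intro n
    have heq : C n = (fun (w : ℕ → S) (i : Fin n) ↦ w i) ⁻¹' {f | IsReduced (List.ofFn f)} := by
      ext w
      have : factor w 0 n = List.ofFn fun i : Fin n ↦ w i := by
        apply List.ext_getElem <;> simp [factor]
      simp [C, this]
    rw [heq]
    exact (isClosed_discrete _).preimage (continuous_pi fun i ↦ continuous_apply _)
  have hanti : ∀ n, C (n + 1) ⊆ C n := by
    intro n w hw
    simp only [C, Set.mem_ofPred_eq, factor_succ] at hw ⊢
    exact hw.of_append_left
  have hne : ∀ n, (C n).Nonempty := by
    intro n
    have hinf : {v : List S | IsReduced v}.Infinite := by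
      intro hfin
      refine Set.infinite_univ (α := Γ) ((hfin.image wordVal).subset ?_)
      intro g _
      obtain ⟨m, hm⟩ := hgen g
      obtain ⟨u, hu⟩ := exists_wordVal_eq hm
      obtain ⟨v, hv, hvu⟩ := exists_isReduced u
      exact ⟨v, hv, hvu.trans hu⟩
    obtain ⟨v, hv, hvn⟩ := hinf.exists_notMem_finite (List.finite_length_lt S n)
    simp only [Set.mem_ofPred_eq, not_lt] at hvn
    refine ⟨fun i ↦ v.getD i ⟨1, h1⟩, ?_⟩
    have : factor (fun i ↦ v.getD i ⟨1, h1⟩) 0 n = v.take n := by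
      apply List.ext_getElem
      · simp [hvn]
      · intro i h2 h3
        simp only [length_factor] at h2
        simp [factor, List.getElem?_eq_getElem (show i < v.length by omega)]
    simp only [C, Set.mem_ofPred_eq, this]
    rw [← List.take_append_drop n v] at hv
    exact hv.of_append_left
  obtain ⟨w, hw⟩ := IsCompact.nonempty_iInter_of_sequence_nonempty_isCompact_isClosed C hanti hne
    (hclosed 0).isCompact hclosed
  refine ⟨w, fun i n ↦ ?_⟩
  have := Set.mem_iInter.1 hw (i + n)
  simp only [C, Set.mem_ofPred_eq, factor_add, zero_add] at this
  exact this.of_append_right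

/-- An infinite finitely generated group of at most linear growth has an element of infinite
order. -/
lemma exists_not_isOfFinOrder_of_linear_growth [Infinite Γ] (h1 : (1 : Γ) ∈ S)
    (hgen : ∀ g : Γ, ∃ n, g ∈ S ^ n) {M : ℕ} (hM : ∀ r, 1 ≤ r → (S ^ r).card < M * r) :
    ∃ g : Γ, ¬ IsOfFinOrder g := by
  obtain ⟨w, hw⟩ := exists_infinite_reduced_word h1 hgen
  by_cases hper : ∃ n, (Set.range fun i ↦ factor w i (n + 1)).ncard ≤
      (Set.range fun i ↦ factor w i n).ncard
  · obtain ⟨n, hn⟩ := hper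
    obtain ⟨i, d, hd, hid⟩ := exists_period w hn
    -- If the period had finite order, a nonempty factor would have value `1`, contradicting
    -- reducedness, since the empty word is shorter.
    refine ⟨wordVal (factor w i d), fun hfin ↦ ?_⟩
    obtain ⟨k, hk, hk1⟩ := isOfFinOrder_iff_pow_eq_one.1 hfin
    rw [← wordVal_factor_mul hid] at hk1
    refine hw i (k * d) [] (by rw [hk1]; rfl) (List.Shortlex.of_length_lt ?_)
    simpa using ⟨hk, hd⟩
  · push Not at hper
    exfalso
    have hp : ∀ n, n + 1 ≤ (Set.range fun i ↦ factor w i n).ncard := by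
      intro n
      induction n with
      | zero =>
        rw [Nat.succ_le_iff, Set.ncard_pos (finite_range_factor w 0)]
        exact ⟨_, 0, rfl⟩
      | succ n ih => exact lt_of_le_of_lt ih (hper n)
    let P : ℕ → Finset (List S) := fun n ↦ (finite_range_factor w n).toFinset
    have hPcard : ∀ n, n + 1 ≤ (P n).card := by
      intro n
      have := hp n
      rwa [Set.ncard_eq_toFinset_card _ (finite_range_factor w n)] at this
    have hsum : ∀ R, ∑ n ∈ Finset.range (R + 1), (n + 1) ≤ (S ^ R).card := by
      intro R
      classical
      calc ∑ n ∈ Finset.range (R + 1), (n + 1) ≤ ∑ n ∈ Finset.range (R + 1), (P n).card :=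
            Finset.sum_le_sum fun n _ ↦ hPcard n
        _ = ((Finset.range (R + 1)).biUnion P).card := by
            rw [Finset.card_biUnion]
            intro m _ n _ hmn
            refine Finset.disjoint_left.2 ?_
            intro u hu hv
            simp only [P, Set.Finite.mem_toFinset, Set.mem_range] at hu hv
            obtain ⟨i, rfl⟩ := hu
            obtain ⟨j, hj⟩ := hv
            have := congrArg List.length hj
            simp only [length_factor] at this
            exact hmn this.symm
        _ ≤ (S ^ R).card := by
            refine Finset.card_le_card_of_injOn wordVal ?_ ?_
            · intro u hu
              simp only [P, Finset.coe_biUnion, Finset.mem_coe, Finset.mem_range, Set.mem_iUnion,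
                Set.Finite.coe_toFinset, Set.mem_range] at hu
              obtain ⟨n, hn, i, rfl⟩ := hu
              have := wordVal_mem_pow (factor w i n)
              rw [length_factor] at this
              exact pow_subset_pow_of_one_mem h1 (by omega) this
            · intro u hu v hv huv
              simp only [P, Finset.coe_biUnion, Finset.mem_coe, Finset.mem_range, Set.mem_iUnion,
                Set.Finite.coe_toFinset, Set.mem_range] at hu hv
              obtain ⟨n, hn, i, rfl⟩ := hu
              obtain ⟨m, hm, j, rfl⟩ := hv
              exact (hw i n).eq_of_wordVal_eq (hw j m) huv
    -- Distinct reduced words have distinct values, so the ball of radius `R` has at least `(R +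
    -- 1)(R + 2) / 2` elements; `R = 2M + 1` already exceeds `M * R`.
    have h2 := hsum (2 * M + 1)
    have h3 := hM (2 * M + 1) (by omega)
    have h4 : ∀ q : ℕ, (∑ n ∈ Finset.range q, (n + 1)) * 2 = q * (q + 1) := by
      intro q
      induction q with
      | zero => simp
      | succ q ih => rw [Finset.sum_range_succ, add_mul, ih]; ring
    have h5 := h4 (2 * M + 1 + 1)
    nlinarith

/-- In a group of at most linear growth, an element of infinite order generates a subgroup of
finite index. -/
lemma finiteIndex_zpowers_of_linear_growth (h1 : (1 : Γ) ∈ S)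
    (hgen : ∀ g : Γ, ∃ n, g ∈ S ^ n) {M : ℕ} (hM : ∀ r, 1 ≤ r → (S ^ r).card < M * r)
    {g : Γ} (hg : ¬ IsOfFinOrder g) : (Subgroup.zpowers g).FiniteIndex := by
  classical
  by_contra hfi
  set C := Subgroup.zpowers g with hC
  have hinf : Infinite (Γ ⧸ C) := by
    by_contra hnot
    rw [not_infinite_iff_finite] at hnot
    exact hfi Subgroup.finiteIndex_of_finite_quotient
  let P : ℕ → Finset (Γ ⧸ C) := fun r ↦ (S ^ r).image (QuotientGroup.mk)
  have hsub : ∀ r, P r ⊆ P (r + 1) := fun r ↦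
    Finset.image_subset_image (pow_subset_pow_of_one_mem h1 (Nat.le_succ r))
  have hP : ∀ r, r + 1 ≤ (P r).card := by
    intro r
    induction r with
    | zero => simp [P]
    | succ r ih =>
      refine lt_of_le_of_lt ih (Finset.card_lt_card ((hsub r).ssubset_of_ne fun heq ↦ ?_))
      -- Left multiplication by `S` acts on the cosets, so once the set of cosets met by balls stops
      -- growing it is stationary, and the index would be finite.
      have hall : ∀ n, P (r + n) = P r := by
        intro n
        induction n with
        | zero => rfl
        | succ n ihn =>
          refine le_antisymm ?_ ?_
          · intro q hq
            simp only [P, Finset.mem_image] at hq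
            obtain ⟨x, hx, rfl⟩ := hq
            rw [← add_assoc, pow_succ'] at hx
            obtain ⟨s, hs, y, hy, rfl⟩ := Finset.mem_mul.1 hx
            have hy' : (QuotientGroup.mk y : Γ ⧸ C) ∈ P r := by
              rw [← ihn]
              exact Finset.mem_image_of_mem _ hy
            obtain ⟨z, hz, hzy⟩ := Finset.mem_image.1 hy'
            rw [heq]
            refine Finset.mem_image.2 ⟨s * z, ?_, ?_⟩
            · rw [pow_succ']
              exact Finset.mul_mem_mul hs hz
            · rw [QuotientGroup.eq] at hzy ⊢
              simpa [mul_assoc] using hzy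
          · rw [← ihn]
            exact hsub _
      refine Set.infinite_univ (α := Γ ⧸ C) ((P r).finite_toSet.subset ?_)
      intro q _
      obtain ⟨x, rfl⟩ := QuotientGroup.mk_surjective q
      obtain ⟨n, hn⟩ := hgen x
      rw [← hall n]
      exact Finset.mem_image_of_mem _ (pow_subset_pow_of_one_mem h1 (Nat.le_add_left n r) hn)
  obtain ⟨k, hk⟩ := hgen g
  -- Quadratic growth: `r + 1` coset representatives times the powers `g ^ i`, `i ≤ r`, are pairwise
  -- distinct because `g` has infinite order.
  have hbig : ∀ r, (r + 1) * (r + 1) ≤ (S ^ (r + k * r)).card := by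
    intro r
    have hsec : ∀ q : Γ ⧸ C, ∃ x : Γ, q ∈ P r → x ∈ S ^ r ∧ (QuotientGroup.mk x : Γ ⧸ C) = q := by
      intro q
      by_cases hq : q ∈ P r
      · obtain ⟨x, hx, hxq⟩ := Finset.mem_image.1 hq
        exact ⟨x, fun _ ↦ ⟨hx, hxq⟩⟩
      · exact ⟨1, fun h ↦ absurd h hq⟩
    choose x hx using hsec
    calc (r + 1) * (r + 1) ≤ (P r).card * (r + 1) := Nat.mul_le_mul_right _ (hP r)
      _ = (P r ×ˢ Finset.range (r + 1)).card := by rw [Finset.card_product, Finset.card_range]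
      _ ≤ (S ^ (r + k * r)).card := by
        refine Finset.card_le_card_of_injOn (fun p ↦ x p.1 * g ^ p.2) ?_ ?_
        · rintro ⟨q, i⟩ hp
          simp only [Finset.coe_product, Set.mem_prod, Finset.mem_coe, Finset.mem_range] at hp
          change x q * g ^ i ∈ S ^ (r + k * r)
          rw [pow_add]
          refine Finset.mul_mem_mul (hx q hp.1).1 ?_
          have h5 : g ^ i ∈ (S ^ k) ^ i := Finset.pow_mem_pow hk
          rw [← pow_mul] at h5
          exact pow_subset_pow_of_one_mem h1 (Nat.mul_le_mul_left _ (by omega)) h5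
        · rintro ⟨q, i⟩ hp ⟨q', i'⟩ hp' heq
          simp only [Finset.coe_product, Set.mem_prod, Finset.mem_coe, Finset.mem_range] at hp hp'
          simp only at heq
          have hq : q = q' := by
            rw [← (hx q hp.1).2, ← (hx q' hp'.1).2, QuotientGroup.eq]
            have : (x q)⁻¹ * x q' = g ^ i * (g ^ i')⁻¹ := by
              rw [inv_mul_eq_iff_eq_mul, ← mul_assoc, heq]
              simp
            rw [this]
            exact C.mul_mem (C.pow_mem (Subgroup.mem_zpowers g) _)
              (C.inv_mem (C.pow_mem (Subgroup.mem_zpowers g) _))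
          subst hq
          have := injective_pow_iff_not_isOfFinOrder.2 hg (mul_left_cancel heq)
          rw [this]
  have h2 := hbig (M * (k + 1) + 1)
  have h3 := hM (M * (k + 1) + 1 + k * (M * (k + 1) + 1)) (by omega)
  nlinarith

lemma isVirtuallyCyclic_of_linear_growth (h1 : (1 : Γ) ∈ S)
    (hgen : ∀ g : Γ, ∃ n, g ∈ S ^ n) {M : ℕ} (hM : ∀ r, 1 ≤ r → (S ^ r).card < M * r) :
    IsVirtuallyCyclic Γ := by
  rcases finite_or_infinite Γ with hfin | hinf
  · exact ⟨⊥, inferInstance, inferInstance⟩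
  · obtain ⟨g, hg⟩ := exists_not_isOfFinOrder_of_linear_growth h1 hgen hM
    exact ⟨Subgroup.zpowers g, inferInstance, finiteIndex_zpowers_of_linear_growth h1 hgen hM hg⟩

lemma inv_pow_eq_of_inv_eq (hS : S⁻¹ = S) (n : ℕ) : (S ^ n)⁻¹ = S ^ n := by
  rw [← inv_pow, hS]

lemma exists_mem_pow_of_closure_eq_top (hS : S⁻¹ = S)
    (h : Subgroup.closure (S : Set Γ) = ⊤) (g : Γ) : ∃ n, g ∈ S ^ n := by
  have hg : g ∈ Subgroup.closure (S : Set Γ) := by rw [h]; trivial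
  induction hg using Subgroup.closure_induction with
  | mem x hx => exact ⟨1, by simpa using hx⟩
  | one => exact ⟨0, by simp⟩
  | mul x y _ _ hx hy =>
    obtain ⟨m, hm⟩ := hx
    obtain ⟨n, hn⟩ := hy
    exact ⟨m + n, by rw [pow_add]; exact Finset.mul_mem_mul hm hn⟩
  | inv x _ hx =>
    obtain ⟨m, hm⟩ := hx
    exact ⟨m, by rw [← inv_pow_eq_of_inv_eq hS]; exact Finset.inv_mem_inv hm⟩

/-- A group that is not locally virtually cyclic has superlinear growth. -/
theorem exists_superlinear_growth (h : ¬ IsLocallyVirtuallyCyclic Γ) :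
    ∃ S : Finset Γ, 1 ∈ S ∧ S⁻¹ = S ∧ ∀ M : ℕ, ∃ r, 1 ≤ r ∧ M * r ≤ (S ^ r).card := by
  unfold IsLocallyVirtuallyCyclic at h
  push Not at h
  obtain ⟨K, hK, hKc⟩ := h
  obtain ⟨A, hA⟩ := ((Group.fg_iff_subgroup_fg K).2 hK).out
  set B : Finset K := insert 1 (A ∪ A⁻¹) with hB
  have hB1 : (1 : K) ∈ B := by simp [hB]
  have hBinv : B⁻¹ = B := by
    ext x
    simp only [hB, Finset.mem_inv', Finset.mem_insert, Finset.mem_union, inv_eq_one, inv_inv]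
    tauto
  have hBgen : Subgroup.closure (B : Set K) = ⊤ := by
    rw [eq_top_iff, ← hA]
    exact Subgroup.closure_mono (by
      intro x hx
      simp only [hB, Finset.coe_insert, Finset.coe_union]
      exact Or.inr (Or.inl hx))
  refine ⟨B.image K.subtype, Finset.mem_image.2 ⟨1, hB1, rfl⟩, ?_, ?_⟩
  · rw [← Finset.image_inv, hBinv]
  · intro M
    by_contra! hcon
    refine hKc (isVirtuallyCyclic_of_linear_growth hB1
      (exists_mem_pow_of_closure_eq_top hBinv hBgen) (M := M) fun r hr ↦ ?_)
    have := hcon r hr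
    rwa [← Finset.image_pow, Finset.card_image_of_injective _ K.subtype_injective] at this

end Growth

/-! ### Subcover numbers of joins -/

section Covers

variable {X : Type*}

/-- The pieces `f i` need not be open; this later permits pieces cut out by conditions on the orbit.
-/
lemma minSubcover_le_of_refine {𝒰 : Set (Set X)} {ι : Type*} [Fintype ι] (f : ι → Set X)
    (hcov : ∀ x, ∃ i, x ∈ f i) (href : ∀ i, ∃ W ∈ 𝒰, f i ⊆ W) :
    minSubcover 𝒰 ≤ Fintype.card ι := by
  choose W hW hfW using href
  have h1 : minSubcover 𝒰 ≤ (Set.range W).ncard := by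
    refine Nat.sInf_le ⟨Set.range W, ?_, Set.finite_range W, ?_, rfl⟩
    · rintro _ ⟨i, rfl⟩
      exact hW i
    · refine Set.eq_univ_of_forall fun x ↦ ?_
      obtain ⟨i, hi⟩ := hcov x
      exact ⟨W i, ⟨i, rfl⟩, hfW i hi⟩
  refine h1.trans ?_
  rw [← Set.image_univ]
  refine (Set.ncard_image_le Set.finite_univ).trans ?_
  rw [Set.ncard_univ, Nat.card_eq_fintype_card]

lemma exists_minSubcover {𝒰 : Set (Set X)} (hfin : 𝒰.Finite) (hcov : ⋃₀ 𝒰 = Set.univ) :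
    ∃ f : Fin (minSubcover 𝒰) → Set X, (∀ i, f i ∈ 𝒰) ∧ ∀ x, ∃ i, x ∈ f i := by
  have hne : {n : ℕ | ∃ 𝒱 ⊆ 𝒰, 𝒱.Finite ∧ ⋃₀ 𝒱 = Set.univ ∧ 𝒱.ncard = n}.Nonempty :=
    ⟨_, 𝒰, subset_rfl, hfin, hcov, rfl⟩
  obtain ⟨𝒱, hsub, hVfin, hVcov, hcard⟩ := Nat.sInf_mem hne
  change 𝒱.ncard = minSubcover 𝒰 at hcard
  have hc : Nat.card 𝒱 = minSubcover 𝒰 := hcard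
  have := hVfin.to_subtype
  let e : 𝒱 ≃ Fin (minSubcover 𝒰) := Finite.equivFinOfCardEq hc
  refine ⟨fun i ↦ (e.symm i : Set X), fun i ↦ hsub (e.symm i).2, fun x ↦ ?_⟩
  have hx : x ∈ ⋃₀ 𝒱 := by rw [hVcov]; trivial
  obtain ⟨V, hV, hxV⟩ := hx
  exact ⟨e ⟨V, hV⟩, by simpa using hxV⟩

variable {G : Type*} [Group G] [MulAction G X]

lemma mem_iInter_inv_smul {F : Finset G} {U : G → Set X} {x : X} :
    x ∈ ⋂ s ∈ F, s⁻¹ • U s ↔ ∀ s ∈ F, s • x ∈ U s := by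
  simp [Set.mem_inv_smul_set_iff]

lemma finite_coverJoin {𝒰 : Set (Set X)} (h : 𝒰.Finite) (F : Finset G) :
    (coverJoin 𝒰 F).Finite := by
  have := h.to_subtype
  refine (Set.finite_range fun u : F → 𝒰 ↦ ⋂ s : F, (s : G)⁻¹ • (u s : Set X)).subset ?_
  rintro W ⟨U, hU, rfl⟩
  refine ⟨fun s ↦ ⟨U s, hU s s.2⟩, ?_⟩
  ext x
  simp

lemma sUnion_coverJoin {𝒰 : Set (Set X)} (h : ⋃₀ 𝒰 = Set.univ) (F : Finset G) :
    ⋃₀ coverJoin 𝒰 F = Set.univ := by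
  refine Set.eq_univ_of_forall fun x ↦ ?_
  have hx : ∀ s : G, ∃ U ∈ 𝒰, s • x ∈ U := by
    intro s
    have : s • x ∈ ⋃₀ 𝒰 := by rw [h]; trivial
    exact this
  choose U hU hxU using hx
  exact ⟨_, ⟨U, fun s _ ↦ hU s, rfl⟩, mem_iInter_inv_smul.2 fun s _ ↦ hxU s⟩

lemma log_natCast_le_of_le_mul {k m n : ℕ} (h : k ≤ m * n) :
    Real.log k ≤ Real.log m + Real.log n := by
  rcases Nat.eq_zero_or_pos k with rfl | hk
  · simpa using add_nonneg (Real.log_natCast_nonneg m) (Real.log_natCast_nonneg n)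
  · have hmn : 0 < m * n := lt_of_lt_of_le hk h
    have hm : (m : ℝ) ≠ 0 := by
      rintro h0
      simp_all
    have hn : (n : ℝ) ≠ 0 := by
      rintro h0
      simp_all
    rw [← Real.log_mul hm hn]
    exact Real.log_le_log (by exact_mod_cast hk) (by exact_mod_cast h)

variable [DecidableEq G] [TopologicalSpace X]

lemma isSubInv_log_minSubcover {𝒰 : Set (Set X)} (h : IsFiniteOpenCover 𝒰) :
    IsSubInv (fun F : Finset G ↦ Real.log (minSubcover (coverJoin 𝒰 F))) where
  empty := by
    have : minSubcover (coverJoin 𝒰 (∅ : Finset G)) ≤ 1 := by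
      refine minSubcover_le_of_refine (ι := Unit) (fun _ ↦ Set.univ) (fun x ↦ ⟨(), trivial⟩) ?_
      exact fun _ ↦ ⟨_, ⟨fun _ ↦ ∅, by simp, rfl⟩, by simp⟩
    exact Real.log_nonpos (by positivity) (by exact_mod_cast this)
  union A B := by
    refine log_natCast_le_of_le_mul ?_
    obtain ⟨f, hf, hfc⟩ := exists_minSubcover (finite_coverJoin h.finite A)
      (sUnion_coverJoin h.cover A)
    obtain ⟨g, hg, hgc⟩ := exists_minSubcover (finite_coverJoin h.finite B)
      (sUnion_coverJoin h.cover B)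
    have := minSubcover_le_of_refine (𝒰 := coverJoin 𝒰 (A ∪ B))
      (fun p : Fin (minSubcover (coverJoin 𝒰 A)) × Fin (minSubcover (coverJoin 𝒰 B)) ↦
        f p.1 ∩ g p.2) ?_ ?_
    · simpa using this
    · intro x
      obtain ⟨i, hi⟩ := hfc x
      obtain ⟨j, hj⟩ := hgc x
      exact ⟨(i, j), hi, hj⟩
    · rintro ⟨i, j⟩
      obtain ⟨U, hU, hUf⟩ := hf i
      obtain ⟨V, hV, hVg⟩ := hg j
      refine ⟨_, ⟨fun s ↦ if s ∈ A then U s else V s, ?_, rfl⟩, ?_⟩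
      · intro s hs
        by_cases hsA : s ∈ A
        · simpa [hsA] using hU s hsA
        · simpa [hsA] using hV s ((Finset.mem_union.1 hs).resolve_left hsA)
      · rintro x ⟨hx1, hx2⟩
        simp only at hx1 hx2
        rw [hUf, mem_iInter_inv_smul] at hx1
        rw [hVg, mem_iInter_inv_smul] at hx2
        rw [mem_iInter_inv_smul]
        intro s hs
        by_cases hsA : s ∈ A
        · simpa [hsA] using hx1 s hsA
        · simpa [hsA] using hx2 s ((Finset.mem_union.1 hs).resolve_left hsA)
  inv A c := by
    have hle : minSubcover (coverJoin 𝒰 (rtrans A c)) ≤ minSubcover (coverJoin 𝒰 A) := by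
      obtain ⟨f, hf, hfc⟩ := exists_minSubcover (finite_coverJoin h.finite A)
        (sUnion_coverJoin h.cover A)
      have := minSubcover_le_of_refine (𝒰 := coverJoin 𝒰 (rtrans A c))
        (fun i ↦ (c • ·) ⁻¹' f i) (fun x ↦ hfc (c • x)) ?_
      · simpa using this
      · intro i
        obtain ⟨U, hU, hUf⟩ := hf i
        refine ⟨_, ⟨fun s ↦ U (s * c⁻¹), fun s hs ↦ hU _ (mem_rtrans.1 hs), rfl⟩, ?_⟩
        intro x hx
        rw [Set.mem_preimage, hUf, mem_iInter_inv_smul] at hx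
        rw [mem_iInter_inv_smul]
        intro s hs
        have := hx _ (mem_rtrans.1 hs)
        rwa [smul_smul, inv_mul_cancel_right] at this
    simpa using log_natCast_le_of_le_mul (n := 1) (by simpa using hle)

end Covers

/-! ### Entropy and almost invariant sets -/

section Folner

variable {G : Type*} [Group G] [DecidableEq G]

lemma IsFolnerSeq.eventually_bdry_le {F : ℕ → Finset G} (hF : IsFolnerSeq F) (K : Finset G)
    {δ : ℝ} (hδ : 0 < δ) :
    ∀ᶠ n in atTop, (F n).Nonempty ∧ (bdry K (F n) : ℝ) ≤ δ * (F n).card := by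
  let _ : MeasurableSpace G := ⊤
  have hdisc : DiscreteMeasurableSpace G := ⟨fun _ ↦ trivial⟩
  have hF' : IsFoelner G (Measure.count : Measure G) atTop (fun n ↦ (F n : Set G)) := hF
  have hne : ∀ᶠ n in atTop, (F n).Nonempty := by
    filter_upwards [hF'.eventually_meas_ne_zero] with n hn
    rw [Finset.nonempty_iff_ne_empty]
    rintro h0
    simp [h0] at hn
  have hsmall : ∀ g : G, ∀ᶠ n in atTop,
      (((F n).filter fun f ↦ g * f ∉ F n).card : ℝ) ≤ δ / (K.card + 1) * (F n).card := by
    intro g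
    have hpos : (0 : ℝ≥0∞) < ENNReal.ofReal (δ / (K.card + 1)) :=
      ENNReal.ofReal_pos.2 (by positivity)
    filter_upwards [(hF'.tendsto_meas_smul_symmDiff g).eventually_lt_const hpos, hne] with n hn hnn
    have hpos' : (0 : ℝ) < (F n).card := by exact_mod_cast hnn.card_pos
    have hset : ((((F n).filter fun f ↦ g * f ∉ F n).image (g * ·) : Finset G) : Set G) ⊆
        symmDiff (g • (F n : Set G)) (F n : Set G) := by
      intro x hx
      simp only [Finset.coe_image, Finset.coe_filter, Set.mem_image, Set.mem_ofPred_eq] at hx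
      obtain ⟨f, ⟨hf, hgf⟩, rfl⟩ := hx
      exact Or.inl ⟨Set.smul_mem_smul_set hf, hgf⟩
    have hcard : (((F n).filter fun f ↦ g * f ∉ F n).card : ℝ≥0∞) ≤
        Measure.count (symmDiff (g • (F n : Set G)) (F n : Set G)) := by
      rw [← Finset.card_image_of_injective _ (mul_right_injective g),
        ← Measure.count_apply_finset]
      exact measure_mono hset
    have h1 : (((F n).filter fun f ↦ g * f ∉ F n).card : ℝ≥0∞) / (F n).card ≤
        ENNReal.ofReal (δ / (K.card + 1)) := by
      refine le_trans ?_ hn.le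
      rw [Measure.count_apply_finset]
      gcongr
    rw [ENNReal.div_le_iff (by simpa using hnn.ne_empty) (by simp)] at h1
    have h2 := ENNReal.toReal_mono (by finiteness) h1
    rw [ENNReal.toReal_mul, ENNReal.toReal_ofReal (by positivity)] at h2
    simpa using h2
  have hall := (Filter.eventually_all_finset K).2 fun g _ ↦ hsmall g
  filter_upwards [hall, hne] with n hn hnn
  refine ⟨hnn, ?_⟩
  unfold bdry
  push_cast
  calc ∑ k ∈ K, (((F n).filter fun f ↦ k * f ∉ F n).card : ℝ)
      ≤ ∑ k ∈ K, δ / (K.card + 1) * (F n).card := Finset.sum_le_sum hn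
    _ = (K.card / (K.card + 1)) * (δ * (F n).card) := by
        simp
        field_simp
    _ ≤ 1 * (δ * (F n).card) := by
        gcongr
        rw [div_le_one (by positivity)]
        linarith
    _ = _ := one_mul _

variable {X : Type*} [TopologicalSpace X] [MulAction G X]

/-- The Følner sequence supplies good sets of arbitrary invariance, and Ornstein–Weiss extends the
bound to all sufficiently invariant sets. This is needed because shapes are unrelated to the given
sequence. -/
lemma exists_forall_log_le_of_topEntropy_lt {F : ℕ → Finset G} (hF : IsFolnerSeq F) {a : ℝ}
    (ha0 : 0 ≤ a) (ha : topEntropy X F < a) {𝒰 : Set (Set X)} (h : IsFiniteOpenCover 𝒰)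
    {η : ℝ} (hη : 0 < η) :
    ∃ (K : Finset G) (δ : ℝ), 0 < δ ∧ ∀ A : Finset G, (bdry K A : ℝ) ≤ δ * A.card →
      Real.log (minSubcover (coverJoin 𝒰 A)) ≤ (a + η) * A.card := by
  refine exists_forall_le_of_supply (isSubInv_log_minSubcover h)
    (fun A ↦ Real.log_natCast_nonneg _) ha0 (fun K δ hδ ↦ ?_) hη
  have hlim : limsup (fun n : ℕ ↦ ((Real.log (minSubcover (coverJoin 𝒰 (F n))) /
      ((F n).card : ℝ) : ℝ) : EReal)) atTop < a :=
    lt_of_le_of_lt (le_iSup (fun 𝒰 : {𝒰 : Set (Set X) // IsFiniteOpenCover 𝒰} ↦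
      limsup (fun n : ℕ ↦ ((Real.log (minSubcover (coverJoin 𝒰.1 (F n))) /
      ((F n).card : ℝ) : ℝ) : EReal)) atTop) ⟨𝒰, h⟩) ha
  obtain ⟨n, hn, hne, hb⟩ := ((eventually_lt_of_limsup_lt hlim).and
    (hF.eventually_bdry_le K hδ)).exists
  refine ⟨F n, hne, hb, ?_⟩
  have hpos : (0 : ℝ) < (F n).card := by exact_mod_cast hne.card_pos
  rw [EReal.coe_lt_coe_iff, div_lt_iff₀ hpos] at hn
  exact hn.le

/-- Hence on the target side it is enough to exhibit one good set for each degree of invariance. -/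
lemma limsup_log_le_of_supply {F : ℕ → Finset G} (hF : IsFolnerSeq F) {a : ℝ}
    (ha0 : 0 ≤ a) {𝒰 : Set (Set X)} (h : IsFiniteOpenCover 𝒰)
    (hsup : ∀ (K : Finset G) (δ : ℝ), 0 < δ → ∃ T : Finset G, T.Nonempty ∧
      (bdry K T : ℝ) ≤ δ * T.card ∧ Real.log (minSubcover (coverJoin 𝒰 T)) ≤ a * T.card)
    {η : ℝ} (hη : 0 < η) :
    limsup (fun n : ℕ ↦ ((Real.log (minSubcover (coverJoin 𝒰 (F n))) /
      ((F n).card : ℝ) : ℝ) : EReal)) atTop ≤ ((a + η : ℝ) : EReal) := by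
  obtain ⟨K, δ, hδ, hK⟩ := exists_forall_le_of_supply (isSubInv_log_minSubcover h)
    (fun A ↦ Real.log_natCast_nonneg _) ha0 hsup hη
  refine limsup_le_of_le (by isBoundedDefault) ?_
  filter_upwards [hF.eventually_bdry_le K hδ] with n ⟨hne, hb⟩
  have hpos : (0 : ℝ) < (F n).card := by exact_mod_cast hne.card_pos
  rw [EReal.coe_le_coe_iff, div_le_iff₀ hpos]
  exact hK _ hb

end Folner

/-! ### Orbit cocycles and shapes -/

/-- The pair of mutually inverse cocycles of a continuous orbit equivalence `Φ`, the second one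
written as a function on `X`. -/
structure OrbitCocycle (G H X Y : Type*) [Group G] [TopologicalSpace X] [MulAction G X]
    [Group H] [TopologicalSpace Y] [MulAction H Y] where
  /-- The orbit equivalence. -/
  Φ : X ≃ₜ Y
  /-- The cocycle with values in `H`. -/
  k : G → X → H
  /-- The cocycle with values in `G`. -/
  l : H → X → G
  k_mul : ∀ g g' x, k (g * g') x = k g (g' • x) * k g' x
  l_mul : ∀ s t x, l (s * t) x = l s (l t x • x) * l t x
  k_l : ∀ t x, k (l t x) x = t
  l_k : ∀ g x, l (k g x) x = g
  Φ_l : ∀ t x, Φ (l t x • x) = t • Φ x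
  isOpen_l : ∀ t g, IsOpen {x | l t x = g}
  finite_k : ∀ g, (Set.range (k g)).Finite
  finite_l : ∀ t, (Set.range (l t)).Finite

lemma ContinuouslyOrbitEquivalent.symm {G H X Y : Type*}
    [Group G] [TopologicalSpace G] [TopologicalSpace X] [MulAction G X]
    [Group H] [TopologicalSpace H] [TopologicalSpace Y] [MulAction H Y]
    (h : ContinuouslyOrbitEquivalent G X H Y) : ContinuouslyOrbitEquivalent H Y G X := by
  obtain ⟨Φ, κ, l, hκ, hl, h1, h2⟩ := h
  exact ⟨Φ.symm, l, κ, hl, hκ, h2, h1⟩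

lemma eq_of_smul_eq_of_stabilizer_eq_bot {G X : Type*} [Group G] [MulAction G X] {x : X}
    (hx : MulAction.stabilizer G x = ⊥) {g h : G} (hgh : g • x = h • x) : g = h := by
  have : h⁻¹ * g ∈ MulAction.stabilizer G x := by
    rw [MulAction.mem_stabilizer_iff, mul_smul, hgh, inv_smul_smul]
  rw [hx, Subgroup.mem_bot] at this
  exact (inv_mul_eq_one.1 this).symm

/-- The cocycle and inverse identities hold where stabilizers are trivial, and extend by density
since both sides are continuous into a discrete group. Finiteness of the ranges is compactness of
`X`. -/
lemma ContinuouslyOrbitEquivalent.nonempty_orbitCocycle {G H X Y : Type*}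
    [Group G] [TopologicalSpace G] [DiscreteTopology G]
    [Group H] [TopologicalSpace H] [DiscreteTopology H]
    [TopologicalSpace X] [CompactSpace X] [TopologicalSpace Y]
    [MulAction G X] [ContinuousSMul G X] [MulAction H Y] [ContinuousSMul H Y]
    (hX : IsTopologicallyFree G X) (hY : IsTopologicallyFree H Y)
    (h : ContinuouslyOrbitEquivalent G X H Y) : Nonempty (OrbitCocycle G H X Y) := by
  obtain ⟨Φ, κ, l, hκ, hl, h1, h2⟩ := h
  have hκc : ∀ g, Continuous fun x ↦ κ (g, x) := fun g ↦ hκ.comp (by fun_prop)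
  have hlc : ∀ t, Continuous fun y ↦ l (t, y) := fun t ↦ hl.comp (by fun_prop)
  have hlc' : ∀ t, Continuous fun x ↦ l (t, Φ x) := fun t ↦ (hlc t).comp Φ.continuous
  have hGc : ∀ g : G, Continuous fun x : X ↦ g • x := fun g ↦ continuous_const_smul g
  have hHc : ∀ t : H, Continuous fun y : Y ↦ t • y := fun t ↦ continuous_const_smul t
  have hΦl : ∀ t x, Φ (l (t, Φ x) • x) = t • Φ x := by
    intro t x
    have := h2 t (Φ x)
    rw [Φ.symm_apply_apply] at this
    rw [← this, Φ.apply_symm_apply]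
  have hdense : Dense {x : X | MulAction.stabilizer H (Φ x) = ⊥} :=
    hY.preimage Φ.isOpenMap
  refine ⟨⟨Φ, fun g x ↦ κ (g, x), fun t x ↦ l (t, Φ x), ?_, ?_, ?_, ?_, hΦl, ?_, ?_, ?_⟩⟩
  · intro g g' x
    refine congrFun (Continuous.ext_on hdense (hκc (g * g'))
      (((hκc g).comp (hGc g')).mul (hκc g')) fun x hx ↦ ?_) x
    refine eq_of_smul_eq_of_stabilizer_eq_bot hx ?_
    rw [← h1, mul_smul, h1, h1, smul_smul]
    rfl
  · intro s t x
    have key : (fun y ↦ l (s * t, y)) = fun y ↦ l (s, t • y) * l (t, y) := by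
      have hd : Dense {y : Y | MulAction.stabilizer G (Φ.symm y) = ⊥} :=
        hX.preimage Φ.symm.isOpenMap
      refine Continuous.ext_on hd (hlc (s * t)) (((hlc s).comp (hHc t)).mul (hlc t)) fun y hy ↦ ?_
      refine eq_of_smul_eq_of_stabilizer_eq_bot hy ?_
      rw [← h2, mul_smul, h2, h2, smul_smul]
    rw [hΦl]
    exact congrFun key (Φ x)
  · intro t x
    have hcont : Continuous fun x ↦ κ (l (t, Φ x), x) := hκ.comp ((hlc' t).prodMk continuous_id)
    refine congrFun (Continuous.ext_on hdense hcont (continuous_const (y := t)) fun x hx ↦ ?_) x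
    refine eq_of_smul_eq_of_stabilizer_eq_bot hx ?_
    rw [← h1, hΦl]
  · intro g x
    have hcont : Continuous fun x ↦ l (κ (g, x), Φ x) := hl.comp ((hκc g).prodMk Φ.continuous)
    refine congrFun (Continuous.ext_on hX hcont (continuous_const (y := g)) fun x hx ↦ ?_) x
    refine eq_of_smul_eq_of_stabilizer_eq_bot hx ?_
    apply Φ.injective
    rw [hΦl, h1]
  · intro t g
    exact (isOpen_discrete {g}).preimage (hlc' t)
  · exact fun g ↦ (isCompact_range (hκc g)).finite_of_discrete
  · exact fun t ↦ (isCompact_range (hlc' t)).finite_of_discrete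

namespace OrbitCocycle

variable {G H X Y : Type*} [Group G] [TopologicalSpace X] [MulAction G X]
    [Group H] [TopologicalSpace Y] [MulAction H Y] (c : OrbitCocycle G H X Y)

lemma k_one (x : X) : c.k 1 x = 1 := by
  have := c.k_mul 1 1 x
  rw [mul_one, one_smul] at this
  exact left_eq_mul.1 this

lemma l_one (x : X) : c.l 1 x = 1 := by
  have := c.l_k 1 x
  rwa [k_one] at this

lemma l_injective (x : X) : Function.Injective fun t ↦ c.l t x :=
  fun t t' h ↦ by
    have := congrArg (fun g ↦ c.k g x) h
    simpa [c.k_l] using this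

/-- The finite set of values of the cocycle `k` on `A`. -/
noncomputable def kVals [DecidableEq H] (A : Finset G) : Finset H := A.biUnion fun g ↦ (c.finite_k g).toFinset

variable {c}

lemma k_mem_kVals [DecidableEq H] {A : Finset G} {g : G} (hg : g ∈ A) (x : X) : c.k g x ∈ c.kVals A := by
  simp only [kVals, Finset.mem_biUnion, Set.Finite.mem_toFinset]
  exact ⟨g, hg, x, rfl⟩

variable [DecidableEq G]

/-- The finite set of values of the cocycle `l` on `A`. -/
noncomputable def lVals (c : OrbitCocycle G H X Y) (A : Finset H) : Finset G := A.biUnion fun t ↦ (c.finite_l t).toFinset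

lemma l_mem_lVals {A : Finset H} {t : H} (ht : t ∈ A) (x : X) : c.l t x ∈ c.lVals A := by
  simp only [lVals, Finset.mem_biUnion, Set.Finite.mem_toFinset]
  exact ⟨t, ht, x, rfl⟩

lemma mem_lVals {A : Finset H} {g : G} : g ∈ c.lVals A ↔ ∃ t ∈ A, ∃ x, c.l t x = g := by
  simp [lVals]

lemma one_le_card_lVals [Nonempty X] {A : Finset H} (hA : A.Nonempty) :
    1 ≤ (c.lVals A).card := by
  obtain ⟨t, ht⟩ := hA
  exact Finset.card_pos.2 ⟨_, l_mem_lVals ht (Classical.arbitrary X)⟩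

/-- The subset of `G` corresponding to `T` along the orbit of `x`. -/
def shape (c : OrbitCocycle G H X Y) (T : Finset H) (x : X) : Finset G := T.image fun t ↦ c.l t x

lemma card_shape (T : Finset H) (x : X) : (c.shape T x).card = T.card :=
  Finset.card_image_of_injective _ (c.l_injective x)

lemma l_mem_shape {T : Finset H} {t : H} {x : X} : c.l t x ∈ c.shape T x ↔ t ∈ T :=
  (c.l_injective x).mem_finset_image (s := T)

variable [DecidableEq H]

lemma lVals_mul_subset (A B : Finset H) : c.lVals (A * B) ⊆ c.lVals A * c.lVals B := by
  intro g hg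
  obtain ⟨t, ht, x, rfl⟩ := mem_lVals.1 hg
  obtain ⟨a, ha, b, hb, rfl⟩ := Finset.mem_mul.1 ht
  rw [c.l_mul]
  exact Finset.mul_mem_mul (l_mem_lVals ha _) (l_mem_lVals hb _)

lemma card_lVals_mul_le (A B : Finset H) :
    (c.lVals (A * B)).card ≤ (c.lVals A).card * (c.lVals B).card :=
  (Finset.card_le_card (lVals_mul_subset A B)).trans Finset.card_mul_le

lemma card_lVals_pow_le (A : Finset H) (n : ℕ) :
    (c.lVals (A ^ n)).card ≤ (c.lVals A).card ^ n := by
  induction n with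
  | zero =>
    rw [pow_zero, pow_zero, Finset.card_le_one]
    have : ∀ g ∈ c.lVals (1 : Finset H), g = 1 := by
      intro g hg
      obtain ⟨t, ht, x, rfl⟩ := mem_lVals.1 hg
      rw [Finset.mem_one.1 ht, l_one]
    intro g hg g' hg'
    rw [this g hg, this g' hg']
  | succ n ih =>
    rw [pow_succ, pow_succ]
    exact (card_lVals_mul_le _ _).trans (Nat.mul_le_mul_right _ ih)

/-- If `q` moves `l t x` out of the shape, then `k q (l t x • x)`, one of the finitely many values
of `k q`, moves `t` out of `T`. -/
lemma bdry_shape_le (Q : Finset G) (T : Finset H) (x : X) :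
    bdry Q (c.shape T x) ≤ Q.card * bdry (c.kVals Q) T := by
  rw [bdry, ← smul_eq_mul]
  refine Finset.sum_le_card_nsmul _ _ _ fun q hq ↦ ?_
  refine le_trans ?_ (card_filter_exists_le_bdry (c.kVals Q) T)
  rw [← Finset.card_image_of_injective _ (c.l_injective x)]
  refine Finset.card_le_card fun f hf ↦ ?_
  obtain ⟨hf, hqf⟩ := Finset.mem_filter.1 hf
  obtain ⟨t, ht, rfl⟩ := Finset.mem_image.1 hf
  refine Finset.mem_image_of_mem _ (Finset.mem_filter.2
    ⟨ht, c.k q (c.l t x • x), k_mem_kVals hq _, fun hmem ↦ hqf ?_⟩)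
  have : q * c.l t x = c.l (c.k q (c.l t x • x) * t) x := by
    rw [c.l_mul, c.l_k]
  rw [this]
  exact l_mem_shape.2 hmem

end OrbitCocycle

/-! ### Connected almost invariant sets -/

section Connectivity

variable {H : Type*} [Group H]

/-- One step inside `T` by left multiplication with an element of `S`. -/
def Step (S T : Finset H) (u v : H) : Prop := u ∈ T ∧ v ∈ T ∧ ∃ s ∈ S, v = s * u

/-- Reachability inside `T` by left multiplications with elements of `S`. -/
def Reach (S T : Finset H) : H → H → Prop := Relation.ReflTransGen (Step S T)

variable {S T : Finset H}

lemma exists_exit_of_reach {S T : Finset H} {P : H → Prop} {u v : H} (h : Reach S T u v)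
    (hu : P u) (hv : ¬ P v) :
    ∃ a b, Reach S T u a ∧ Step S T a b ∧ P a ∧ ¬ P b := by
  unfold Reach at h
  induction h with
  | refl => exact absurd hu hv
  | @tail b c hub hbc ih =>
    by_cases hb : P b
    · exact ⟨b, c, hub, hbc, hb, hv⟩
    · exact ih hb

lemma card_mul_card_le_of_disjoint_translates {B Z U : Finset H}
    (hU : ∀ b ∈ B, ∀ z ∈ Z, b * z ∈ U)
    (hdisj : ∀ z ∈ Z, ∀ z' ∈ Z, ∀ b ∈ B, ∀ b' ∈ B, b * z = b' * z' → z = z') :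
    B.card * Z.card ≤ U.card := by
  rw [← Finset.card_product]
  refine Finset.card_le_card_of_injOn (fun p ↦ p.1 * p.2) ?_ ?_
  · rintro ⟨b, z⟩ hp
    obtain ⟨hb, hz⟩ := Finset.mem_product.1 hp
    exact hU b hb z hz
  · rintro ⟨b, z⟩ hp ⟨b', z'⟩ hp' heq
    obtain ⟨hb, hz⟩ := Finset.mem_product.1 hp
    obtain ⟨hb', hz'⟩ := Finset.mem_product.1 hp'
    have h2 := hdisj z hz z' hz' b hb b' hb' heq
    subst h2
    simp only [mul_left_inj] at heq
    rw [heq]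

variable [DecidableEq H]

lemma Reach.symm (hS : S⁻¹ = S) {u v : H} (h : Reach S T u v) : Reach S T v u := by
  have : Std.Symm (Step S T) := ⟨fun a b hab ↦ by
    obtain ⟨ha, hb, s, hs, rfl⟩ := hab
    refine ⟨hb, ha, s⁻¹, ?_, by simp⟩
    rw [← hS]
    exact Finset.inv_mem_inv hs⟩
  exact Relation.ReflTransGen.stdSymm.symm _ _ h

/-- Every set contains, up to translation, a connected set that is at least as invariant. -/
lemma exists_connected (hS : S⁻¹ = S) {T₀ : Finset H} (hne : T₀.Nonempty) {δ : ℝ}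
    (hT₀ : (bdry S T₀ : ℝ) ≤ δ * T₀.card) :
    ∃ T : Finset H, 1 ∈ T ∧ (bdry S T : ℝ) ≤ δ * T.card ∧ ∀ t ∈ T, Reach S T 1 t := by
  classical
  -- Take a set of minimal size. Were it disconnected, the boundaries of the component of `1` and of
  -- its complement would add up to at most that of `T`, so one of the two parts would satisfy the
  -- same bound with fewer points.
  let P : ℕ → Prop := fun n ↦
    ∃ T : Finset H, 1 ∈ T ∧ (bdry S T : ℝ) ≤ δ * T.card ∧ T.card = n
  have htrans : ∀ A : Finset H, A.Nonempty → (bdry S A : ℝ) ≤ δ * A.card → P A.card := by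
    rintro A ⟨u, hu⟩ hA
    refine ⟨rtrans A u⁻¹, ?_, ?_, card_rtrans _ _⟩
    · rw [mem_rtrans]
      simpa using hu
    · rwa [bdry_rtrans, card_rtrans]
  have hP : ∃ n, P n := ⟨_, htrans T₀ hne hT₀⟩
  obtain ⟨T, h1, hb, hcard⟩ := Nat.find_spec hP
  refine ⟨T, h1, hb, ?_⟩
  by_contra! hcon
  obtain ⟨t, ht, hnr⟩ := hcon
  set A := T.filter fun u ↦ Reach S T 1 u with hA
  set B := T.filter fun u ↦ ¬ Reach S T 1 u with hB
  have hAB : A.card + B.card = T.card := Finset.card_filter_add_card_filter_not _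
  have hA1 : 1 ∈ A := Finset.mem_filter.2 ⟨h1, Relation.ReflTransGen.refl⟩
  have hBt : t ∈ B := Finset.mem_filter.2 ⟨ht, hnr⟩
  have hApos : 0 < A.card := Finset.card_pos.2 ⟨1, hA1⟩
  have hBpos : 0 < B.card := Finset.card_pos.2 ⟨t, hBt⟩
  have hbd : bdry S A + bdry S B ≤ bdry S T := by
    unfold bdry
    rw [← Finset.sum_add_distrib]
    refine Finset.sum_le_sum fun s hs ↦ ?_
    rw [← Finset.card_union_of_disjoint]
    · refine Finset.card_le_card fun u hu ↦ ?_
      rcases Finset.mem_union.1 hu with hu | hu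
      · obtain ⟨huA, hsu⟩ := Finset.mem_filter.1 hu
        obtain ⟨huT, hur⟩ := Finset.mem_filter.1 huA
        refine Finset.mem_filter.2 ⟨huT, fun hsT ↦ hsu (Finset.mem_filter.2 ⟨hsT, ?_⟩)⟩
        exact Relation.ReflTransGen.tail hur ⟨huT, hsT, s, hs, rfl⟩
      · obtain ⟨huB, hsu⟩ := Finset.mem_filter.1 hu
        obtain ⟨huT, hur⟩ := Finset.mem_filter.1 huB
        refine Finset.mem_filter.2 ⟨huT, fun hsT ↦ hsu (Finset.mem_filter.2 ⟨hsT, ?_⟩)⟩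
        intro hr
        refine hur (Relation.ReflTransGen.tail hr ⟨hsT, huT, s⁻¹, ?_, by simp⟩)
        rw [← hS]
        exact Finset.inv_mem_inv hs
    · rw [Finset.disjoint_left]
      intro u hu hu'
      have h3 := (Finset.mem_filter.1 (Finset.mem_filter.1 hu).1).2
      exact (Finset.mem_filter.1 (Finset.mem_filter.1 hu').1).2 h3
  have hbd' : (bdry S A : ℝ) + bdry S B ≤ bdry S T := by exact_mod_cast hbd
  have hAB' : (A.card : ℝ) + B.card = T.card := by exact_mod_cast hAB
  rcases le_or_gt (bdry S A : ℝ) (δ * A.card) with hle | hgt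
  · exact Nat.find_min hP (by omega) (htrans A ⟨1, hA1⟩ hle)
  · refine Nat.find_min hP (by omega) (htrans B ⟨t, hBt⟩ ?_)
    rw [← hAB'] at hb
    linarith

/-- A point leaving `T` under a product of `n` elements of `S` leaves it at one of the `n`
successive steps. -/
lemma bdry_pow_le (S T : Finset H) (n : ℕ) : bdry (S ^ n) T ≤ (S ^ n).card * (n * bdry S T) := by
  have key : ∀ n, ∀ w ∈ S ^ n, (T.filter fun t ↦ w * t ∉ T).card ≤ n * bdry S T := by
    intro n
    induction n with
    | zero =>
      intro w hw
      rw [pow_zero, Finset.mem_one] at hw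
      subst hw
      rw [Finset.filter_false_of_mem (by simp)]
      simp
    | succ n ih =>
      intro w hw
      rw [pow_succ'] at hw
      obtain ⟨s, hs, w, hw', rfl⟩ := Finset.mem_mul.1 hw
      have h2 : (T.filter fun t ↦ s * t ∉ T).card ≤ bdry S T :=
        Finset.single_le_sum (f := fun s ↦ (T.filter fun t ↦ s * t ∉ T).card)
          (fun _ _ ↦ Nat.zero_le _) hs
      calc (T.filter fun t ↦ s * w * t ∉ T).card
          ≤ ((T.filter fun t ↦ w * t ∉ T) ∪
              (T.filter fun t ↦ s * t ∉ T).image (w⁻¹ * ·)).card := by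
            refine Finset.card_le_card fun t ht ↦ ?_
            obtain ⟨ht, hst⟩ := Finset.mem_filter.1 ht
            by_cases hwt : w * t ∈ T
            · refine Finset.mem_union_right _ (Finset.mem_image.2 ⟨w * t, ?_, by simp⟩)
              exact Finset.mem_filter.2 ⟨hwt, by rwa [← mul_assoc]⟩
            · exact Finset.mem_union_left _ (Finset.mem_filter.2 ⟨ht, hwt⟩)
        _ ≤ n * bdry S T + bdry S T :=
            (Finset.card_union_le _ _).trans
              (add_le_add (ih w hw') (Finset.card_image_le.trans h2))
        _ = (n + 1) * bdry S T := by ring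
  rw [bdry, ← smul_eq_mul (a := (S ^ n).card)]
  exact Finset.sum_le_card_nsmul _ _ _ (key n)

lemma card_union_mul_le (B T : Finset H) : (T ∪ B * T).card ≤ T.card + bdry B T := by
  have hsub : T ∪ B * T ⊆ T ∪ B.biUnion fun b ↦ (T.filter fun t ↦ b * t ∉ T).image (b * ·) := by
    intro g hg
    by_cases hgT : g ∈ T
    · exact Finset.mem_union_left _ hgT
    · refine Finset.mem_union_right _ ?_
      obtain ⟨b, hb, t, ht, rfl⟩ := Finset.mem_mul.1 ((Finset.mem_union.1 hg).resolve_left hgT)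
      exact Finset.mem_biUnion.2 ⟨b, hb, Finset.mem_image_of_mem _ (Finset.mem_filter.2 ⟨ht, hgT⟩)⟩
  refine (Finset.card_le_card hsub).trans ((Finset.card_union_le _ _).trans ?_)
  refine add_le_add le_rfl (Finset.card_biUnion_le.trans ?_)
  exact Finset.sum_le_sum fun _ _ ↦ Finset.card_image_le

lemma reach_mul_of_pow_subset (h1 : 1 ∈ S) {ρ : ℕ} {d : H} (hd : ∀ w ∈ S ^ ρ, w * d ∈ T) {n : ℕ}
    (hn : n ≤ ρ) : ∀ w ∈ S ^ n, Reach S T d (w * d) := by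
  induction n with
  | zero =>
    intro w hw
    rw [pow_zero, Finset.mem_one] at hw
    subst hw
    rw [one_mul]
    exact Relation.ReflTransGen.refl
  | succ n ih =>
    intro w hw
    have hwT := hd w (pow_subset_pow_of_one_mem h1 hn hw)
    rw [pow_succ'] at hw
    obtain ⟨s, hs, w, hw', rfl⟩ := Finset.mem_mul.1 hw
    refine Relation.ReflTransGen.tail (ih (by omega) w hw') ⟨?_, hwT, s, hs, by rw [mul_assoc]⟩
    exact hd w (pow_subset_pow_of_one_mem h1 (by omega) hw')

/-- Points of `T` in distinct `S`-components are few if `T` is almost invariant. -/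
lemma card_mul_card_le_of_not_reach (h1 : 1 ∈ S) (hS : S⁻¹ = S) {D : Finset H} (hDT : D ⊆ T)
    (hD : ∀ d ∈ D, ∀ d' ∈ D, Reach S T d d' → d = d') (ρ : ℕ) :
    (S ^ ρ).card * D.card ≤ T.card + (S ^ ρ).card * bdry (S ^ ρ) T := by
  classical
  -- Points whose whole `S^ρ`-ball lies in `T` have disjoint balls, since a common point would join
  -- their components; the remaining points are counted by the boundary.
  set D₁ := D.filter fun d ↦ ∀ w ∈ S ^ ρ, w * d ∈ T
  set D₂ := D.filter fun d ↦ ¬ ∀ w ∈ S ^ ρ, w * d ∈ T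
  have hcard : D₁.card + D₂.card = D.card := Finset.card_filter_add_card_filter_not _
  have hD₁ : (S ^ ρ).card * D₁.card ≤ T.card := by
    refine card_mul_card_le_of_disjoint_translates ?_ ?_
    · intro b hb z hz
      exact (Finset.mem_filter.1 hz).2 b hb
    · intro z hz z' hz' b hb b' hb' heq
      obtain ⟨hzD, hz⟩ := Finset.mem_filter.1 hz
      obtain ⟨hzD', hz'⟩ := Finset.mem_filter.1 hz'
      refine hD z hzD z' hzD' ?_
      have h2 := reach_mul_of_pow_subset h1 hz le_rfl b hb
      have h3 := reach_mul_of_pow_subset h1 hz' le_rfl b' hb'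
      rw [heq] at h2
      exact Relation.ReflTransGen.trans h2 (h3.symm hS)
  have hD₂ : D₂.card ≤ bdry (S ^ ρ) T := by
    refine le_trans (Finset.card_le_card fun d hd ↦ ?_) (card_filter_exists_le_bdry (S ^ ρ) T)
    obtain ⟨hdD, hd⟩ := Finset.mem_filter.1 hd
    push Not at hd
    exact Finset.mem_filter.2 ⟨hDT hdD, hd⟩
  rw [← hcard, mul_add]
  exact add_le_add hD₁ (Nat.mul_le_mul_left _ hD₂)

end Connectivity

/-! ### Sparse nets with few cocycle values -/

namespace OrbitCocycle

variable {G H X Y : Type*} [Group G] [TopologicalSpace X] [MulAction G X]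
    [Group H] [TopologicalSpace Y] [MulAction H Y]

/-- The restrictions to `Z` of the maps `t ↦ l t x`, `x ∈ X`, number at most `N`. -/
def RestrLE (c : OrbitCocycle G H X Y) (Z : Finset H) (N : ℕ) : Prop :=
  ∃ 𝒵 : Finset (H → G), 𝒵.card ≤ N ∧ ∀ x, ∃ ζ ∈ 𝒵, ∀ z ∈ Z, c.l z x = ζ z

variable {c : OrbitCocycle G H X Y} [DecidableEq G] [DecidableEq H]

/-- By the cocycle identity, `l (w * z) x` is `l z x` multiplied on the left by one of the values of
`l w`. -/
lemma RestrLE.insert {Z : Finset H} {N : ℕ} (h : c.RestrLE Z N) {A : Finset H} {w z : H}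
    (hw : w ∈ A) (hz : z ∈ Z) : c.RestrLE (insert (w * z) Z) (N * (c.lVals A).card) := by
  classical
  obtain ⟨𝒵, hcard, h𝒵⟩ := h
  refine ⟨Finset.image₂ (fun ζ g ↦ Function.update ζ (w * z) (g * ζ z)) 𝒵 (c.lVals A),
    (Finset.card_image₂_le _ _ _).trans (Nat.mul_le_mul_right _ hcard), fun x ↦ ?_⟩
  obtain ⟨ζ, hζ, hx⟩ := h𝒵 x
  refine ⟨_, Finset.mem_image₂_of_mem hζ (l_mem_lVals hw (c.l z x • x)), fun u hu ↦ ?_⟩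
  by_cases huw : u = w * z
  · subst huw
    rw [Function.update_self, c.l_mul, hx z hz]
  · rw [Function.update_of_ne huw]
    exact hx u ((Finset.mem_insert.1 hu).resolve_left huw)

/-- Existence of a sparse net in a connected set on which the cocycle takes few values. -/
lemma exists_net [Nonempty X] {S S₂ T : Finset H} (h1 : 1 ∈ S) (hS : S⁻¹ = S)
    (hS₂ : S₂.Nonempty) (hT1 : 1 ∈ T) (hT : ∀ t ∈ T, Reach S₂ T 1 t) (r : ℕ) :
    ∃ Z D : Finset H, Z ⊆ T ∧ D ⊆ T ∧
      (∀ t ∈ T, ∃ d ∈ D, Reach S T d t) ∧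
      (∀ t ∈ T, ∃ w ∈ S ^ (2 * r), ∃ z ∈ Z ∪ D, t = w * z) ∧
      (∀ z ∈ Z, ∀ z' ∈ Z, ∀ b ∈ S ^ r, ∀ b' ∈ S ^ r, b * z = b' * z' → z = z') ∧
      (∀ d ∈ D, ∀ d' ∈ D, Reach S T d d' → d = d') ∧
      c.RestrLE (Z ∪ D) ((c.lVals S).card ^ ((2 * r + 1) * Z.card) *
        ((c.lVals S₂).card * (c.lVals S).card ^ (2 * r)) ^ D.card) := by
  classical
  -- A pair of maximal total size: `Z` holds the separated net points, `D` one base point for each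
  -- `S`-component reached. The count records the price paid when each point was added.
  let P : Finset H × Finset H → Prop := fun p ↦ 1 ∈ p.2 ∧
      (∀ z ∈ p.1, ∀ z' ∈ p.1, ∀ b ∈ S ^ r, ∀ b' ∈ S ^ r, b * z = b' * z' → z = z') ∧
      (∀ d ∈ p.2, ∀ d' ∈ p.2, Reach S T d d' → d = d') ∧
      c.RestrLE (p.1 ∪ p.2) ((c.lVals S).card ^ ((2 * r + 1) * p.1.card) *
        ((c.lVals S₂).card * (c.lVals S).card ^ (2 * r)) ^ p.2.card)
  have hc : 1 ≤ (c.lVals S).card := one_le_card_lVals ⟨1, h1⟩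
  have hc₂ : 1 ≤ (c.lVals S₂).card := one_le_card_lVals hS₂
  have hne : ((T.powerset ×ˢ T.powerset).filter P).Nonempty := by
    refine ⟨(∅, {1}), Finset.mem_filter.2 ⟨by simp [hT1], by simp, by simp, by simp, ?_⟩⟩
    refine ⟨{fun _ ↦ 1}, ?_, fun x ↦ ⟨_, Finset.mem_singleton_self _, ?_⟩⟩
    · simpa using Nat.mul_le_mul hc₂ (Nat.one_le_pow (2 * r) _ hc)
    · simp [l_one]
  obtain ⟨⟨Z, D⟩, hmem, hmax⟩ := Finset.exists_max_image _
    (fun p : Finset H × Finset H ↦ p.1.card + p.2.card) hne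
  simp only [Finset.mem_filter, Finset.mem_product, Finset.mem_powerset] at hmem hmax
  obtain ⟨⟨hZT, hDT⟩, h1D, hsep, hdist, hcnt⟩ := hmem
  have hone : ∀ n, (1 : H) ∈ S ^ n := fun n ↦ Finset.one_mem_pow h1
  let Near : H → Prop := fun t ↦ ∃ w ∈ S ^ (2 * r), ∃ z ∈ Z ∪ D, t = w * z
  have hnear : ∀ z ∈ Z ∪ D, Near z := fun z hz ↦ ⟨1, hone _, z, hz, by simp⟩
  have ha : ∀ t, (∃ d ∈ D, Reach S T d t) → Near t := by
    rintro t ⟨d, hd, hdt⟩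
    by_contra hcon
    -- The first exit from the `S^(2r)`-neighbourhood of `Z ∪ D` lies in its
    -- `S^(2r+1)`-neighbourhood, and its `r`-ball misses those of `Z`. It could be added to `Z`,
    -- against maximality.
    obtain ⟨u, v, -, ⟨-, hvT, s, hs, rfl⟩, ⟨w, hw, z, hz, rfl⟩, hnv⟩ :=
      exists_exit_of_reach hdt (hnear d (Finset.mem_union_right _ hd)) hcon
    have hvZ : s * (w * z) ∉ Z := fun h ↦ hnv (hnear _ (Finset.mem_union_left _ h))
    have hPnew : P (insert (s * (w * z)) Z, D) := by
      refine ⟨h1D, ?_, hdist, ?_⟩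
      · have hkey : ∀ z' ∈ Z, ∀ b ∈ S ^ r, ∀ b' ∈ S ^ r, b * (s * (w * z)) ≠ b' * z' := by
          intro z' hz' b hb b' hb' heq
          refine hnv ⟨b⁻¹ * b', ?_, z', Finset.mem_union_left _ hz', ?_⟩
          · rw [two_mul, pow_add]
            refine Finset.mul_mem_mul ?_ hb'
            rw [← inv_pow_eq_of_inv_eq hS]
            exact Finset.inv_mem_inv hb
          · rw [mul_assoc, ← heq, inv_mul_cancel_left]
        intro y hy y' hy' b hb b' hb' heq
        rcases Finset.mem_insert.1 hy with rfl | hy <;>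
          rcases Finset.mem_insert.1 hy' with rfl | hy'
        · rfl
        · exact absurd heq (hkey _ hy' b hb b' hb')
        · exact absurd heq.symm (hkey _ hy b' hb' b hb)
        · exact hsep y hy y' hy' b hb b' hb' heq
      · have hsw : s * w ∈ S ^ (2 * r + 1) := by
          rw [pow_succ']
          exact Finset.mul_mem_mul hs hw
        have hR := hcnt.insert hsw hz
        rw [mul_assoc s w z] at hR
        obtain ⟨𝒵, hcard, h𝒵⟩ := hR
        refine ⟨𝒵, hcard.trans ?_, by simpa [Finset.insert_union] using h𝒵⟩
        refine (Nat.mul_le_mul_left _ (card_lVals_pow_le S _)).trans (le_of_eq ?_)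
        rw [Finset.card_insert_of_notMem hvZ]
        ring
    have := hmax _ ⟨⟨Finset.insert_subset hvT hZT, hDT⟩, hPnew⟩
    simp only [Finset.card_insert_of_notMem hvZ] at this
    omega
  have hb : ∀ t ∈ T, ∃ d ∈ D, Reach S T d t := by
    intro t ht
    by_contra hcon
    -- An `S₂`-path leaving the `S`-components of `D` exits next to a point near the net, so a new
    -- base point costs one `S₂`-step and `2r` steps in `S`.
    obtain ⟨u, v, -, ⟨-, hvT, s, hs, rfl⟩, hu, hnv⟩ :=
      exists_exit_of_reach (P := fun t ↦ ∃ d ∈ D, Reach S T d t) (hT t ht)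
        ⟨1, h1D, Relation.ReflTransGen.refl⟩ hcon
    obtain ⟨w, hw, z, hz, rfl⟩ := ha u hu
    have hvD : s * (w * z) ∉ D := fun h ↦ hnv ⟨_, h, Relation.ReflTransGen.refl⟩
    have hPnew : P (Z, insert (s * (w * z)) D) := by
      refine ⟨Finset.mem_insert_of_mem h1D, hsep, ?_, ?_⟩
      · intro d hd d' hd' hr
        rcases Finset.mem_insert.1 hd with rfl | hd <;>
          rcases Finset.mem_insert.1 hd' with rfl | hd'
        · rfl
        · exact absurd ⟨d', hd', hr.symm hS⟩ hnv
        · exact absurd ⟨d, hd, hr⟩ hnv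
        · exact hdist d hd d' hd' hr
      · have hR := hcnt.insert (Finset.mul_mem_mul hs hw) hz
        rw [mul_assoc s w z] at hR
        obtain ⟨𝒵, hcard, h𝒵⟩ := hR
        refine ⟨𝒵, hcard.trans ?_, by simpa [Finset.union_insert] using h𝒵⟩
        refine (Nat.mul_le_mul_left _ ((card_lVals_mul_le _ _).trans
          (Nat.mul_le_mul_left _ (card_lVals_pow_le S _)))).trans (le_of_eq ?_)
        rw [Finset.card_insert_of_notMem hvD]
        ring
    have := hmax _ ⟨⟨hZT, Finset.insert_subset hvT hDT⟩, hPnew⟩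
    simp only [Finset.card_insert_of_notMem hvD] at this
    omega
  exact ⟨Z, D, hZT, hDT, hb, fun t ht ↦ ha t (hb t ht), hsep, hdist, hcnt⟩

end OrbitCocycle

/-! ### Counting shapes and transferring covers -/

lemma card_small_subsets_le {α : Type*} (M : Finset α) (q : ℝ) {y : ℝ} (hy : 0 ≤ y) :
    ((M.powerset.filter fun B ↦ (B.card : ℝ) ≤ q).card : ℝ) ≤
      Real.exp (y * q + M.card * Real.exp (-y)) := by
  -- Chernoff's method: weight each subset by `exp (-y)` to its cardinality; the total weight is `(1
  -- + exp (-y)) ^ |M|`.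
  have h1 : ((M.powerset.filter fun B ↦ (B.card : ℝ) ≤ q).card : ℝ) * Real.exp (-(y * q)) ≤
      Real.exp (M.card * Real.exp (-y)) := by
    calc ((M.powerset.filter fun B ↦ (B.card : ℝ) ≤ q).card : ℝ) * Real.exp (-(y * q))
        = ∑ B ∈ M.powerset.filter fun B ↦ (B.card : ℝ) ≤ q, Real.exp (-(y * q)) := by simp
      _ ≤ ∑ B ∈ M.powerset.filter fun B ↦ (B.card : ℝ) ≤ q, Real.exp (-y) ^ B.card := by
          refine Finset.sum_le_sum fun B hB ↦ ?_
          rw [← Real.exp_nat_mul]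
          refine Real.exp_le_exp.2 ?_
          have := (Finset.mem_filter.1 hB).2
          nlinarith
      _ ≤ ∑ B ∈ M.powerset, Real.exp (-y) ^ B.card :=
          Finset.sum_le_sum_of_subset_of_nonneg (Finset.filter_subset _ _)
            fun _ _ _ ↦ by positivity
      _ = (Real.exp (-y) + 1) ^ M.card := by
          rw [← Finset.sum_pow_mul_eq_add_pow]
          simp
      _ ≤ Real.exp (Real.exp (-y)) ^ M.card := by
          gcongr
          exact Real.add_one_le_exp _
      _ = Real.exp (M.card * Real.exp (-y)) := by rw [← Real.exp_nat_mul]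
  rw [Real.exp_neg, ← div_eq_mul_inv, div_le_iff₀ (Real.exp_pos _)] at h1
  rwa [add_comm, Real.exp_add]

/-- The pairs `(q, f)` with `q ∈ Q`, `f ∈ F` and `q f ∉ F`. -/
def bdryEdges {G : Type*} [Group G] [DecidableEq G] (Q F : Finset G) : Finset (G × G) :=
  (Q ×ˢ F).filter fun p ↦ p.1 * p.2 ∉ F

lemma card_bdryEdges {G : Type*} [Group G] [DecidableEq G] (Q F : Finset G) :
    (bdryEdges Q F).card = bdry Q F := by
  rw [bdryEdges, bdry, Finset.card_filter, Finset.sum_product]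
  simp only [Finset.card_filter]

namespace OrbitCocycle

variable {G H X Y : Type*} [Group G] [TopologicalSpace X] [MulAction G X]
    [Group H] [TopologicalSpace Y] [MulAction H Y] {c : OrbitCocycle G H X Y} [DecidableEq G]

/-- Follow an `S`-path from a base point. If it left the shape of `x'`, that step would be a
boundary edge for `x'`, hence for `x`; but the step stays in the shape of `x`. -/
lemma shape_subset_of_bdryEdges_eq {S T D : Finset H} (hD : ∀ t ∈ T, ∃ d ∈ D, Reach S T d t)
    {x x' : X} (hxx : ∀ d ∈ D, c.l d x = c.l d x') (hDT : D ⊆ T)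
    (hb : bdryEdges (c.lVals S) (c.shape T x) = bdryEdges (c.lVals S) (c.shape T x')) :
    c.shape T x ⊆ c.shape T x' := by
  intro g hg
  obtain ⟨t, ht, rfl⟩ := Finset.mem_image.1 hg
  obtain ⟨d, hd, hdt⟩ := hD t ht
  clear hg ht
  unfold Reach at hdt
  induction hdt with
  | refl =>
    rw [hxx d hd]
    exact l_mem_shape.2 (hDT hd)
  | @tail u v _ huv ih =>
    obtain ⟨huT, hvT, s, hs, rfl⟩ := huv
    by_contra hcon
    have hmem : (c.l s (c.l u x • x), c.l u x) ∈ bdryEdges (c.lVals S) (c.shape T x') := by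
      refine Finset.mem_filter.2 ⟨Finset.mem_product.2 ⟨l_mem_lVals hs _, ih⟩, ?_⟩
      simp only at hcon ⊢
      rwa [← c.l_mul]
    rw [← hb] at hmem
    refine (Finset.mem_filter.1 hmem).2 ?_
    simp only
    rw [← c.l_mul]
    exact l_mem_shape.2 hvT

lemma l_eq_of_reach {S T D : Finset H} (hD : ∀ t ∈ T, ∃ d ∈ D, Reach S T d t)
    {x x' : X} (hxx : ∀ d ∈ D, c.l d x = c.l d x')
    (hs : ∀ g ∈ c.shape T x, ∀ s ∈ S, c.l s (g • x) = c.l s (g • x')) :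
    ∀ t ∈ T, c.l t x = c.l t x' := by
  intro t ht
  obtain ⟨d, hd, hdt⟩ := hD t ht
  clear ht
  unfold Reach at hdt
  induction hdt with
  | refl => exact hxx d hd
  | @tail u v _ huv ih =>
    obtain ⟨huT, hvT, s, hsS, rfl⟩ := huv
    rw [c.l_mul, c.l_mul, hs _ (l_mem_shape.2 huT) s hsS, ih]

/-- `Y` is cut according to the values of `l` on `Z`, the shape `F`, and a member of an optimal
subcover of the join of `𝒰` over `F`. On one piece `l t` is constant for `t ∈ T`, so the piece
refines the join of `𝒱`. The three terms count these three choices. -/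
lemma log_minSubcover_le [Nonempty X] {𝒱 : Set (Set Y)} (h𝒱 : IsFiniteOpenCover 𝒱)
    {𝒰 : Set (Set X)} (h𝒰 : IsFiniteOpenCover 𝒰) {S R T Z D : Finset H}
    (href : ∀ U ∈ 𝒰, ∃ V ∈ 𝒱, U ⊆ c.Φ ⁻¹' V)
    (hS : ∀ U ∈ 𝒰, ∀ s ∈ S, ∀ x ∈ U, ∀ x' ∈ U, c.l s x = c.l s x')
    (hDT : D ⊆ T) (hDZ : D ⊆ Z) (hD : ∀ t ∈ T, ∃ d ∈ D, Reach S T d t)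
    (hZ : ∀ t ∈ T, ∃ w ∈ R, ∃ z ∈ Z, t = w * z) {N : ℕ} (hN : c.RestrLE Z N)
    {b q y : ℝ} (hb : ∀ x, Real.log (minSubcover (coverJoin 𝒰 (c.shape T x))) ≤ b)
    (hq : ∀ x, (bdry (c.lVals S) (c.shape T x) : ℝ) ≤ q) (hy : 0 ≤ y) :
    Real.log (minSubcover (coverJoin 𝒱 T)) ≤
      Real.log N + (y * q + (c.lVals S).card * ((c.lVals R).card * Z.card) * Real.exp (-y)) +
        b := by
  classical
  obtain ⟨𝒵, hcard, h𝒵⟩ := hN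
  let Data : (H → G) → Finset G → X → Prop := fun ζ F x ↦
    (∀ z ∈ Z, c.l z x = ζ z) ∧ c.shape T x = F
  set P : Finset ((H → G) × Finset G) :=
    (𝒵 ×ˢ (c.lVals T).powerset).filter fun p ↦ ∃ x, Data p.1 p.2 x with hP
  have hPmem : ∀ x, ∃ p ∈ P, Data p.1 p.2 x := by
    intro x
    obtain ⟨ζ, hζ, hx⟩ := h𝒵 x
    refine ⟨(ζ, c.shape T x), Finset.mem_filter.2 ⟨Finset.mem_product.2 ⟨hζ, ?_⟩, x, hx, rfl⟩,
      hx, rfl⟩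
    refine Finset.mem_powerset.2 fun g hg ↦ ?_
    obtain ⟨t, ht, rfl⟩ := Finset.mem_image.1 hg
    exact l_mem_lVals ht x
  set e : ℝ := y * q + (c.lVals S).card * ((c.lVals R).card * Z.card) * Real.exp (-y) with he
  -- `A ζ` contains every shape compatible with the net values `ζ`, so the boundary edges range over
  -- small subsets of `lVals S × A ζ`.
  let A : (H → G) → Finset G := fun ζ ↦ Finset.image₂ (fun g z ↦ g * ζ z) (c.lVals R) Z
  have hA : ∀ ζ, (A ζ).card ≤ (c.lVals R).card * Z.card := fun ζ ↦ Finset.card_image₂_le _ _ _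
  let Sm : (H → G) → Finset (Finset (G × G)) := fun ζ ↦
    ((c.lVals S) ×ˢ A ζ).powerset.filter fun B ↦ (B.card : ℝ) ≤ q
  have hSm : ∀ ζ, ((Sm ζ).card : ℝ) ≤ Real.exp e := by
    intro ζ
    refine (card_small_subsets_le _ q hy).trans (Real.exp_le_exp.2 ?_)
    rw [he, Finset.card_product]
    push_cast
    gcongr
    exact_mod_cast hA ζ
  have hPcard : (P.card : ℝ) ≤ N * Real.exp e := by
    have h1 : P.card ≤ (𝒵.sigma Sm).card := by
      refine Finset.card_le_card_of_injOn
        (fun p ↦ (⟨p.1, bdryEdges (c.lVals S) p.2⟩ : (_ : H → G) × Finset (G × G))) ?_ ?_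
      · rintro ⟨ζ, F⟩ hp
        obtain ⟨hp1, x, hx, hF⟩ := Finset.mem_filter.1 hp
        simp only at hx hF
        subst hF
        refine Finset.mem_sigma.2 ⟨(Finset.mem_product.1 hp1).1, Finset.mem_filter.2
          ⟨Finset.mem_powerset.2 ?_, ?_⟩⟩
        · refine (Finset.filter_subset _ _).trans (Finset.product_subset_product_right ?_)
          intro g hg
          obtain ⟨t, ht, rfl⟩ := Finset.mem_image.1 hg
          obtain ⟨w, hw, z, hz, rfl⟩ := hZ t ht
          refine Finset.mem_image₂.2 ⟨c.l w (c.l z x • x), l_mem_lVals hw _, z, hz, ?_⟩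
          rw [c.l_mul, hx z hz]
        · simp only [card_bdryEdges]
          exact hq x
      · rintro ⟨ζ, F⟩ hp ⟨ζ', F'⟩ hp' heq
        obtain ⟨-, x, hx, hF⟩ := Finset.mem_filter.1 hp
        obtain ⟨-, x', hx', hF'⟩ := Finset.mem_filter.1 hp'
        simp only [Sigma.mk.injEq, heq_eq_eq] at heq hx hF hx' hF'
        obtain ⟨rfl, hbe⟩ := heq
        subst hF hF'
        have hxx : ∀ d ∈ D, c.l d x = c.l d x' := fun d hd ↦
          (hx d (hDZ hd)).trans (hx' d (hDZ hd)).symm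
        have := (shape_subset_of_bdryEdges_eq hD hxx hDT hbe).antisymm
          (shape_subset_of_bdryEdges_eq hD (fun d hd ↦ (hxx d hd).symm) hDT hbe.symm)
        rw [this]
    calc (P.card : ℝ) ≤ ((𝒵.sigma Sm).card : ℝ) := by exact_mod_cast h1
      _ = ∑ ζ ∈ 𝒵, ((Sm ζ).card : ℝ) := by rw [Finset.card_sigma]; push_cast; rfl
      _ ≤ ∑ ζ ∈ 𝒵, Real.exp e := Finset.sum_le_sum fun ζ _ ↦ hSm ζ
      _ = 𝒵.card * Real.exp e := by simp
      _ ≤ N * Real.exp e := by gcongr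
  have hW := fun F : Finset G ↦ exists_minSubcover (finite_coverJoin h𝒰.finite F)
    (sUnion_coverJoin h𝒰.cover F)
  choose W hWmem hWcov using hW
  have hcover : minSubcover (coverJoin 𝒱 T) ≤
      Fintype.card ((p : P) × Fin (minSubcover (coverJoin 𝒰 p.1.2))) := by
    refine minSubcover_le_of_refine (fun i : (p : P) × Fin (minSubcover (coverJoin 𝒰 p.1.2)) ↦
      {v : Y | c.Φ.symm v ∈ W i.1.1.2 i.2 ∧ Data i.1.1.1 i.1.1.2 (c.Φ.symm v)}) ?_ ?_
    · intro v
      obtain ⟨p, hp, hpx⟩ := hPmem (c.Φ.symm v)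
      obtain ⟨i, hi⟩ := hWcov p.2 (c.Φ.symm v)
      exact ⟨⟨⟨p, hp⟩, i⟩, hi, hpx⟩
    · rintro ⟨⟨⟨ζ, F⟩, hp⟩, i⟩
      simp only
      rcases Set.eq_empty_or_nonempty
        {v : Y | c.Φ.symm v ∈ W F i ∧ Data ζ F (c.Φ.symm v)} with hemp | ⟨v₀, hv₀, hx₀, hF₀⟩
      · rw [hemp]
        have : c.Φ (Classical.arbitrary X) ∈ ⋃₀ coverJoin 𝒱 T := by
          rw [sUnion_coverJoin h𝒱.cover]; trivial
        obtain ⟨V, hV, -⟩ := this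
        exact ⟨V, hV, Set.empty_subset _⟩
      · obtain ⟨U, hU, hUW⟩ := hWmem F i
        have hV : ∀ t : H, ∃ V : Set Y, t ∈ T →
            V ∈ 𝒱 ∧ U (c.l t (c.Φ.symm v₀)) ⊆ c.Φ ⁻¹' V := by
          intro t
          by_cases ht : t ∈ T
          · obtain ⟨V, hV, hUV⟩ := href _ (hU (c.l t (c.Φ.symm v₀)) (by
              rw [← hF₀]; exact l_mem_shape.2 ht))
            exact ⟨V, fun _ ↦ ⟨hV, hUV⟩⟩
          · exact ⟨∅, fun h ↦ absurd h ht⟩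
        choose V hV using hV
        refine ⟨_, ⟨V, fun t ht ↦ (hV t ht).1, rfl⟩, ?_⟩
        rintro v ⟨hvW, hx, hF⟩
        rw [hUW, mem_iInter_inv_smul] at hvW hv₀
        rw [mem_iInter_inv_smul]
        have hl := l_eq_of_reach (c := c) hD (x := c.Φ.symm v₀) (x' := c.Φ.symm v)
          (fun d hd ↦ (hx₀ d (hDZ hd)).trans (hx d (hDZ hd)).symm) (by
            intro g hg s hs
            rw [hF₀] at hg
            exact hS _ (hU g hg) s hs _ (hv₀ g hg) _ (hvW g hg))
        intro t ht
        have h2 : c.l t (c.Φ.symm v₀) ∈ F := by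
          rw [← hF₀]; exact l_mem_shape.2 ht
        have h3 := (hV t ht).2 (hvW _ h2)
        rw [hl t ht, Set.mem_preimage, c.Φ_l, c.Φ.apply_symm_apply] at h3
        exact h3
  have hbound : (minSubcover (coverJoin 𝒱 T) : ℝ) ≤ N * (Real.exp e * Real.exp b) := by
    calc (minSubcover (coverJoin 𝒱 T) : ℝ)
        ≤ (Fintype.card ((p : P) × Fin (minSubcover (coverJoin 𝒰 p.1.2))) : ℝ) := by
          exact_mod_cast hcover
      _ = ∑ p : P, (minSubcover (coverJoin 𝒰 p.1.2) : ℝ) := by simp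
      _ ≤ ∑ p : P, Real.exp b := by
          refine Finset.sum_le_sum fun p _ ↦ ?_
          obtain ⟨-, x, -, hx⟩ := Finset.mem_filter.1 p.2
          rw [← hx]
          exact (Real.le_exp_log _).trans (Real.exp_le_exp.2 (hb x))
      _ = P.card * Real.exp b := by simp
      _ ≤ N * Real.exp e * Real.exp b := by gcongr
      _ = _ := by ring
  let x₀ : X := Classical.arbitrary X
  have hb0 : 0 ≤ b := (Real.log_natCast_nonneg _).trans (hb x₀)
  have hq0 : 0 ≤ q := (Nat.cast_nonneg _).trans (hq x₀)
  have he0 : 0 ≤ e := by positivity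
  have hN0 := Real.log_natCast_nonneg N
  rcases Nat.eq_zero_or_pos (minSubcover (coverJoin 𝒱 T)) with h0 | hpos
  · rw [h0]
    simp only [Nat.cast_zero, Real.log_zero]
    linarith
  · have hpos' : (0 : ℝ) < minSubcover (coverJoin 𝒱 T) := by exact_mod_cast hpos
    have hNne : (N : ℝ) ≠ 0 := by
      intro h0
      rw [h0, zero_mul] at hbound
      linarith
    have := Real.log_le_log hpos' hbound
    rw [Real.log_mul hNne (by positivity), ← Real.exp_add, Real.log_exp] at this
    linarith

/-- The pullback of a cover of `Y`, refined by the partitions into the level sets of the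
functions `l s`, `s ∈ S`. -/
def pullbackCover (c : OrbitCocycle G H X Y) (𝒱 : Set (Set Y)) (S : Finset H) : Set (Set X) :=
  Set.range fun p : 𝒱 × (S → c.lVals S) ↦
    c.Φ ⁻¹' (p.1 : Set Y) ∩ ⋂ s : S, {x | c.l s x = p.2 s}

lemma isFiniteOpenCover_pullbackCover {𝒱 : Set (Set Y)} (h : IsFiniteOpenCover 𝒱)
    (S : Finset H) : IsFiniteOpenCover (c.pullbackCover 𝒱 S) where
  finite := by
    have := h.finite.to_subtype
    exact Set.finite_range _
  isOpen := by
    rintro _ ⟨p, rfl⟩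
    exact ((h.isOpen _ p.1.2).preimage c.Φ.continuous).inter
      (isOpen_iInter_of_finite fun s ↦ c.isOpen_l _ _)
  cover := by
    refine Set.eq_univ_of_forall fun x ↦ ?_
    have hx : c.Φ x ∈ ⋃₀ 𝒱 := by rw [h.cover]; trivial
    obtain ⟨V, hV, hxV⟩ := hx
    refine ⟨_, ⟨(⟨V, hV⟩, fun s ↦ ⟨c.l s x, l_mem_lVals s.2 x⟩), rfl⟩, hxV, ?_⟩
    simp

end OrbitCocycle

/-! ### Choice of constants and the entropy inequality -/

lemma eventually_mul_le_nhdsGT_zero (A : ℝ) {B : ℝ} (hB : 0 < B) :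
    ∀ᶠ d : ℝ in 𝓝[>] 0, A * d ≤ B := by
  have h : Tendsto (fun d : ℝ ↦ A * d) (𝓝[>] 0) (𝓝 0) := by
    have : Tendsto (fun d : ℝ ↦ A * d) (𝓝 0) (𝓝 (A * 0)) := tendsto_id.const_mul A
    rw [mul_zero] at this
    exact this.mono_left nhdsWithin_le_nhds
  exact (h.eventually_lt_const hB).mono fun _ h ↦ h.le

/-- The contribution to the count of a net whose `z` points have disjoint balls of size `s`. -/
lemma net_cost_le {r z M s τ B e η : ℝ} (hη : 0 < η) (hr : 1 ≤ r) (hz : 0 ≤ z)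
    (he : 0 ≤ e) (hM : 48 * e / η ≤ M) (hs : M * r ≤ s) (hsz : s * z ≤ τ + B) (hB : B ≤ τ) :
    (2 * r + 1) * z * e ≤ η / 8 * τ := by
  have h6 : M * r * z ≤ 2 * τ := by
    calc M * r * z ≤ s * z := by gcongr
      _ ≤ 2 * τ := by linarith
  have h7 : e ≤ M * η / 48 := by
    rw [div_le_iff₀ hη] at hM
    linarith
  calc (2 * r + 1) * z * e ≤ (3 * r) * z * (M * η / 48) := by
        gcongr
        linarith
    _ = η / 16 * (M * r * z) := by ring
    _ ≤ η / 16 * (2 * τ) := by gcongr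
    _ = _ := by ring

/-- The contribution to the count of `z` base points of components, most of which contain a ball
of size `s`. -/
lemma component_cost_le {z s τ B C η : ℝ} (hη : 0 < η) (hτ : 0 ≤ τ) (hC : 0 ≤ C) (hs : 0 < s)
    (hCs : 16 * C / η ≤ s) (hsz : s * z ≤ τ + s * B) (hB : B ≤ η / (16 * (C + 1)) * τ) :
    z * C ≤ η / 8 * τ := by
  have h5 : C ≤ s * (η / 16) := by
    rw [div_le_iff₀ hη] at hCs
    linarith
  have h6 : C * (η / (16 * (C + 1))) ≤ η / 16 := by
    calc C * (η / (16 * (C + 1))) = η / 16 * (C / (C + 1)) := by field_simp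
      _ ≤ η / 16 * 1 := by
          gcongr
          rw [div_le_one (by positivity)]
          linarith
      _ = η / 16 := mul_one _
  refine le_of_mul_le_mul_left ?_ hs
  calc s * (z * C) = s * z * C := by ring
    _ ≤ (τ + s * (η / (16 * (C + 1)) * τ)) * C := by
        gcongr
        refine hsz.trans ?_
        gcongr
    _ = C * τ + s * (C * (η / (16 * (C + 1)))) * τ := by ring
    _ ≤ s * (η / 16) * τ + s * (η / 16) * τ := by gcongr
    _ = _ := by ring

lemma shape_cost_le {y q d L z τ e η : ℝ} (hτ : 0 ≤ τ) (hqL : 0 ≤ q * L * e)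
    (hz : z ≤ τ) (hd : y * q * d ≤ η / 8) (he : q * L * e ≤ η / 8) :
    y * (q * (d * τ)) + q * (L * z) * e ≤ η / 4 * τ := by
  calc y * (q * (d * τ)) + q * (L * z) * e = y * q * d * τ + q * L * e * z := by ring
    _ ≤ η / 8 * τ + η / 8 * τ :=
        add_le_add (mul_le_mul_of_nonneg_right hd hτ)
          ((mul_le_mul_of_nonneg_left hz hqL).trans (mul_le_mul_of_nonneg_right he hτ))
    _ = _ := by ring

namespace OrbitCocycle

variable {G H X Y : Type*} [Group G] [TopologicalSpace X] [MulAction G X]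
    [Group H] [TopologicalSpace Y] [MulAction H Y]

set_option maxHeartbeats 800000 in
/-- Arbitrarily invariant subsets of `H` along which the covers of `Y` grow at most at a rate
that bounds the entropy of the action of `G` on `X`. -/
theorem exists_invariant_log_minSubcover_le (c : OrbitCocycle G H X Y) [Nonempty X]
    [DecidableEq G] [DecidableEq H] (hH : ¬ IsLocallyVirtuallyCyclic H)
    {F : ℕ → Finset G} (hF : IsFolnerSeq F) {E : ℕ → Finset H} (hE : IsFolnerSeq E)
    {a : ℝ} (ha0 : 0 ≤ a) (ha : topEntropy X F < a) {𝒱 : Set (Set Y)}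
    (h𝒱 : IsFiniteOpenCover 𝒱) {η : ℝ} (hη : 0 < η) (K : Finset H) {δ : ℝ} (hδ : 0 < δ) :
    ∃ T : Finset H, T.Nonempty ∧ (bdry K T : ℝ) ≤ δ * T.card ∧
      Real.log (minSubcover (coverJoin 𝒱 T)) ≤ (a + η) * T.card := by
  obtain ⟨S, h1S, hSinv, hgrow⟩ := exists_superlinear_growth hH
  have h𝒰 := isFiniteOpenCover_pullbackCover (c := c) h𝒱 S
  obtain ⟨KG, δG, hδG, hKG⟩ := exists_forall_log_le_of_topEntropy_lt hF ha0 ha h𝒰 (half_pos hη)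
  set Q := c.lVals S with hQ
  set cS := Real.log (Q.card : ℝ) with hcS
  have hcS0 : 0 ≤ cS := Real.log_natCast_nonneg _
  obtain ⟨M, hM⟩ := exists_nat_ge (48 * cS / η)
  obtain ⟨r, hr1, hr⟩ := hgrow M
  -- `T` must be almost invariant under all of these: the last two make its shapes almost invariant
  -- under `KG` and `Q`. Connectedness is only available for the enlarged set `S₂`.
  set S₂' := S ∪ K ∪ c.kVals KG ∪ c.kVals Q with hS₂'
  set S₂ := S₂' ∪ S₂'⁻¹ with hS₂
  have hS₂inv : S₂⁻¹ = S₂ := by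
    ext s
    simp only [hS₂, Finset.mem_inv', Finset.mem_union, inv_inv]
    exact or_comm
  have hsub' : S₂' ⊆ S₂ := Finset.subset_union_left
  have hSS : S ⊆ S₂ := by
    refine subset_trans ?_ hsub'
    intro s hs; simp [hS₂', hs]
  have hKS : K ⊆ S₂ := by
    refine subset_trans ?_ hsub'
    intro s hs; simp [hS₂', hs]
  have hKGS : c.kVals KG ⊆ S₂ := by
    refine subset_trans ?_ hsub'
    intro s hs; simp [hS₂', hs]
  have hQS : c.kVals Q ⊆ S₂ := by
    refine subset_trans ?_ hsub'
    intro s hs; simp [hS₂', hs]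
  have hS₂ne : S₂.Nonempty := ⟨1, hSS h1S⟩
  set C := Real.log ((c.lVals S₂).card : ℝ) + 2 * r * cS with hC
  have hC0 : 0 ≤ C := by
    have := Real.log_natCast_nonneg (c.lVals S₂).card
    positivity
  -- `C` is the logarithmic price of one base point and depends on `S₂` and `r`; a second radius `ρ`
  -- makes the base points rare enough to absorb it.
  obtain ⟨M', hM'⟩ := exists_nat_ge (16 * C / η)
  obtain ⟨ρ, hρ1, hρ⟩ := hgrow M'
  set R := S ^ (2 * r) with hR
  set β := η / (16 * (C + 1)) with hβ
  have hβ0 : 0 < β := by positivity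
  -- `y` is fixed before the invariance `d`, since the count of boundary edges also contains the
  -- term `y * |Q| * d`.
  obtain ⟨y, hy0, hy⟩ : ∃ y : ℝ, 0 ≤ y ∧
      (Q.card * (c.lVals R).card : ℝ) * Real.exp (-y) ≤ η / 8 := by
    have h2 := (Real.tendsto_exp_neg_atTop_nhds_zero.const_mul
      (Q.card * (c.lVals R).card : ℝ)).eventually_lt_const
      (show (Q.card * (c.lVals R).card : ℝ) * 0 < η / 8 by rw [mul_zero]; positivity)
    obtain ⟨y, hy, hy0⟩ := (h2.and (eventually_ge_atTop 0)).exists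
    exact ⟨y, hy0, hy.le⟩
  obtain ⟨d, hd1, hd2, hd3, hd4, hd5, hd0⟩ :=
    ((eventually_mul_le_nhdsGT_zero 1 hδ).and
    ((eventually_mul_le_nhdsGT_zero ((S ^ r).card * r) one_pos).and
    ((eventually_mul_le_nhdsGT_zero ((S ^ ρ).card * ρ) hβ0).and
    ((eventually_mul_le_nhdsGT_zero KG.card hδG).and
    ((eventually_mul_le_nhdsGT_zero (y * Q.card) (show 0 < η / 8 by positivity)).and
    self_mem_nhdsWithin))))).exists
  have hd0 : 0 < d := hd0
  obtain ⟨n, hne, hbn⟩ := (hE.eventually_bdry_le S₂ hd0).exists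
  obtain ⟨T, h1T, hbT, hTconn⟩ := exists_connected hS₂inv hne hbn
  set τ : ℝ := (T.card : ℝ) with hτ
  have hτ0 : 0 < τ := by
    rw [hτ]
    exact_mod_cast Finset.card_pos.2 ⟨1, h1T⟩
  have hbsub : ∀ A : Finset H, A ⊆ S₂ → (bdry A T : ℝ) ≤ d * τ := by
    intro A hA
    refine le_trans ?_ hbT
    exact_mod_cast bdry_mono hA T
  have hbpow : ∀ m : ℕ, (bdry (S ^ m) T : ℝ) ≤ (S ^ m).card * m * d * τ := by
    intro m
    calc (bdry (S ^ m) T : ℝ) ≤ (S ^ m).card * (m * bdry S T) := by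
          exact_mod_cast bdry_pow_le S T m
      _ ≤ (S ^ m).card * (m * (d * τ)) := by gcongr; exact hbsub S hSS
      _ = _ := by ring
  refine ⟨T, ⟨1, h1T⟩, ?_, ?_⟩
  · refine (hbsub K hKS).trans ?_
    gcongr
    linarith
  obtain ⟨Z, D, hZT, hDT, hreach, hnear, hsep, hdist, hcnt⟩ :=
    exists_net (c := c) h1S hSinv hS₂ne h1T hTconn r
  have hshape : ∀ x, Real.log (minSubcover (coverJoin (c.pullbackCover 𝒱 S) (c.shape T x))) ≤
      (a + η / 2) * τ := by
    intro x
    have h2 := hKG (c.shape T x) ?_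
    · rwa [card_shape] at h2
    · rw [card_shape]
      calc (bdry KG (c.shape T x) : ℝ) ≤ KG.card * bdry (c.kVals KG) T := by
            exact_mod_cast bdry_shape_le KG T x
        _ ≤ KG.card * (d * τ) := by gcongr; exact hbsub _ hKGS
        _ = KG.card * d * τ := by ring
        _ ≤ δG * τ := by gcongr
  have hq : ∀ x, (bdry Q (c.shape T x) : ℝ) ≤ Q.card * (d * τ) := by
    intro x
    calc (bdry Q (c.shape T x) : ℝ) ≤ Q.card * bdry (c.kVals Q) T := by
          exact_mod_cast bdry_shape_le Q T x
      _ ≤ Q.card * (d * τ) := by gcongr; exact hbsub _ hQS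
  have hmain := log_minSubcover_le (c := c) h𝒱 h𝒰 (S := S) (R := R) ?_ ?_ hDT
    Finset.subset_union_right hreach hnear hcnt hshape hq hy0
  rotate_left
  · rintro _ ⟨p, rfl⟩
    exact ⟨_, p.1.2, Set.inter_subset_left⟩
  · rintro _ ⟨p, rfl⟩ s hs x hx x' hx'
    have h2 := Set.mem_iInter.1 hx.2 ⟨s, hs⟩
    have h3 := Set.mem_iInter.1 hx'.2 ⟨s, hs⟩
    exact Eq.trans h2 (Eq.symm h3)
  have hQ1 : 1 ≤ Q.card := one_le_card_lVals ⟨1, h1S⟩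
  have hQ1' : 1 ≤ (c.lVals S₂).card := one_le_card_lVals hS₂ne
  have hlog : Real.log (((Q.card ^ ((2 * r + 1) * Z.card) *
      ((c.lVals S₂).card * Q.card ^ (2 * r)) ^ D.card : ℕ)) : ℝ) =
      (2 * r + 1) * Z.card * cS + D.card * C := by
    have hQp : (Q.card : ℝ) ≠ 0 := by positivity
    have hQp' : ((c.lVals S₂).card : ℝ) ≠ 0 := by positivity
    push_cast
    rw [Real.log_mul (by positivity) (by positivity), Real.log_pow, Real.log_pow,
      Real.log_mul hQp' (by positivity), Real.log_pow]
    push_cast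
    ring
  rw [hlog] at hmain
  have hZcard : (2 * r + 1) * Z.card * cS ≤ η / 8 * τ := by
    have h2 : (S ^ r).card * Z.card ≤ T.card + bdry (S ^ r) T := by
      refine le_trans (card_mul_card_le_of_disjoint_translates ?_ hsep) (card_union_mul_le (S ^ r) T)
      intro b hb z hz
      exact Finset.mem_union_right _ (Finset.mul_mem_mul hb (hZT hz))
    have h3 : ((S ^ r).card : ℝ) * Z.card ≤ τ + bdry (S ^ r) T := by
      rw [hτ]
      exact_mod_cast h2
    have h4 : (bdry (S ^ r) T : ℝ) ≤ τ :=
      (hbpow r).trans (mul_le_of_le_one_left hτ0.le hd2)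
    exact net_cost_le hη (by exact_mod_cast hr1) (Nat.cast_nonneg _) hcS0 hM
      (by exact_mod_cast hr) h3 h4
  have hDcard : D.card * C ≤ η / 8 * τ := by
    have h2 : ((S ^ ρ).card : ℝ) * D.card ≤ τ + (S ^ ρ).card * bdry (S ^ ρ) T := by
      rw [hτ]
      exact_mod_cast card_mul_card_le_of_not_reach h1S hSinv hDT hdist ρ
    have h4 : (bdry (S ^ ρ) T : ℝ) ≤ β * τ :=
      (hbpow ρ).trans (by gcongr)
    have hpos : (0 : ℝ) < (S ^ ρ).card := by
      exact_mod_cast Finset.card_pos.2 ⟨1, Finset.one_mem_pow h1S⟩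
    have h5 : (M' : ℝ) ≤ (S ^ ρ).card := by
      exact_mod_cast (Nat.le_mul_of_pos_right M' hρ1).trans hρ
    exact component_cost_le hη hτ0.le hC0 hpos (hM'.trans h5) h2 h4
  have hcount : y * (Q.card * (d * τ)) +
      Q.card * ((c.lVals R).card * (Z ∪ D).card) * Real.exp (-y) ≤ η / 4 * τ := by
    have h2 : ((Z ∪ D).card : ℝ) ≤ τ := by
      rw [hτ]
      exact_mod_cast Finset.card_le_card (Finset.union_subset hZT hDT)
    exact shape_cost_le hτ0.le (by positivity) h2 hd5 hy
  -- The errors are `η/2` from the entropy on shapes, `η/8` each from `Z` and `D`, and `η/4` from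
  -- the boundary edges.
  linarith only [hmain, hZcard, hDcard, hcount]

theorem topEntropy_le (c : OrbitCocycle G H X Y) (hH : ¬ IsLocallyVirtuallyCyclic H)
    {F : ℕ → Finset G} (hF : IsFolnerSeq F) {E : ℕ → Finset H} (hE : IsFolnerSeq E) :
    topEntropy Y E ≤ topEntropy X F := by
  classical
  refine iSup_le fun 𝒱 ↦ ?_
  obtain ⟨𝒱, h𝒱⟩ := 𝒱
  simp only
  have hnonneg : (0 : EReal) ≤ topEntropy X F := by
    have huniv : IsFiniteOpenCover ({Set.univ} : Set (Set X)) :=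
      ⟨Set.finite_singleton _, by simp, by simp⟩
    refine le_trans ?_ (le_iSup _ ⟨{Set.univ}, huniv⟩)
    refine le_limsup_of_frequently_le (Frequently.of_forall fun n ↦ ?_) (by isBoundedDefault)
    rw [← EReal.coe_zero, EReal.coe_le_coe_iff]
    exact div_nonneg (Real.log_natCast_nonneg _) (Nat.cast_nonneg _)
  refine le_of_forall_gt_imp_ge_of_dense fun b hb ↦ ?_
  obtain ⟨a', ha', hab⟩ := EReal.lt_iff_exists_real_btwn.1 hb
  obtain ⟨a, ha, haa⟩ := EReal.lt_iff_exists_real_btwn.1 ha'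
  have ha0 : 0 ≤ a := by
    have := hnonneg.trans ha.le
    exact_mod_cast this
  have hη : 0 < a' - a := by
    have : a < a' := by exact_mod_cast haa
    linarith
  refine le_trans ?_ hab.le
  have hsup : ∀ (K : Finset H) (δ : ℝ), 0 < δ → ∃ T : Finset H, T.Nonempty ∧
      (bdry K T : ℝ) ≤ δ * T.card ∧
      Real.log (minSubcover (coverJoin 𝒱 T)) ≤ (a + (a' - a) / 2) * T.card := by
    intro K δ hδ
    -- For empty spaces the subcover number is `0`, and `Real.log 0 = 0` keeps the bound true.
    rcases isEmpty_or_nonempty X with hX | hX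
    · obtain ⟨n, hne, hb⟩ := (hE.eventually_bdry_le K hδ).exists
      refine ⟨E n, hne, hb, ?_⟩
      have hY : IsEmpty Y := c.Φ.symm.toEquiv.isEmpty
      have h0 : minSubcover (coverJoin 𝒱 (E n)) ≤ 0 := by
        simpa using minSubcover_le_of_refine (𝒰 := coverJoin 𝒱 (E n)) (ι := Empty)
          (fun _ ↦ ∅) (fun y ↦ (hY.false y).elim) (fun i ↦ i.elim)
      rw [Nat.le_zero.1 h0]
      simp only [Nat.cast_zero, Real.log_zero]
      positivity
    · exact c.exists_invariant_log_minSubcover_le hH hF hE ha0 ha h𝒱 (half_pos hη) K hδ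
  have := limsup_log_le_of_supply hE (by positivity) h𝒱 hsup (half_pos hη)
  rwa [show a + (a' - a) / 2 + (a' - a) / 2 = a' by ring] at this

end OrbitCocycle

end OrbitEntropy

theorem mainTheorem7
    {G H X Y : Type*}
    [Group G] [TopologicalSpace G] [DiscreteTopology G] [Countable G] [Infinite G]
    [Group H] [TopologicalSpace H] [DiscreteTopology H] [Countable H] [Infinite H]
    [TopologicalSpace X] [CompactSpace X] [TopologicalSpace.MetrizableSpace X]
    [TopologicalSpace Y] [CompactSpace Y] [TopologicalSpace.MetrizableSpace Y]
    [MulAction G X] [ContinuousSMul G X] [MulAction H Y] [ContinuousSMul H Y]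
    (hGa : OrbitEntropy.IsAmenable G) (hHa : OrbitEntropy.IsAmenable H)
    (hGc : ¬ OrbitEntropy.IsLocallyVirtuallyCyclic G)
    (hHc : ¬ OrbitEntropy.IsLocallyVirtuallyCyclic H)
    (hX : OrbitEntropy.IsTopologicallyFree G X)
    (hY : OrbitEntropy.IsTopologicallyFree H Y)
    (hcoe : OrbitEntropy.ContinuouslyOrbitEquivalent G X H Y)
    (F : ℕ → Finset G) (hF : OrbitEntropy.IsFolnerSeq F)
    (E : ℕ → Finset H) (hE : OrbitEntropy.IsFolnerSeq E) :
    OrbitEntropy.topEntropy X F = OrbitEntropy.topEntropy Y E := by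
  obtain ⟨c⟩ := hcoe.nonempty_orbitCocycle hX hY
  obtain ⟨c'⟩ := hcoe.symm.nonempty_orbitCocycle hY hX
  exact le_antisymm (c'.topEntropy_le hGc hE hF) (c.topEntropy_le hHc hF hE)
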